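/- There exist absolute constants $c, C > 0$ such that the following holds for every $n$ and every $z \in \mathbb{C}$ with $n|z|^2 \le c$. Let $G_n = L(K_{n,n})$ be the line graph of the complete bipartite graph $K_{n,n}$, with vertex set $[n]\times[n]$, two distinct vertices $(i,j)$ and $(i',j')$ being adjacent, written $(i,j)\sim(i',j')$, if and only if $i=i'$ or $j=j'$. For $x \in \mathbb{C}^{[n]\times[n]}$ let $$Z_{G_n}(x) = \sum_{I} \prod_{v\in I} x_v,$$ where $I$ ranges over the independent sets of $G_n$ (equivalently, the matchings of $K_{n,n}$), and let $$L_1(x) = \sum_{(i,j)} x_{ij}, \qquad L_2(x) = -\frac12\sum_{(i,j)} x_{ij}^2 - \sum_{\{(i,j),(i',j')\}:\,(i,j)\sim(i',j')} x_{ij}x_{i'j'},$$ where the last sum is over unordered pairs of adjacent vertices. Put $$F_n^{(2)}(x) = Z_{G_n}(x)\exp\bigl(-L_1(x)-L_2(x)\bigr).$$ Let $W = (W_{ij})_{1\le i,j\le n}$ have i.i.d. standard complex Gaussian entries, that is, each with density $\frac1\pi e^{-|w|^2}$ on $\mathbb{C}$. Then $\mathbb{E}\,|F_n^{(2)}(zW)|^2$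 is finite and positive, and $$\log \mathbb{E}\bigl[|F_n^{(2)}(zW)|^2\bigr] \le C\,n^4|z|^6.$$ -/

import Mathlib

open MeasureTheory ProbabilityTheory

/-- The standard complex Gaussian law `𝒩_ℂ(0,1)`, with density `π⁻¹ exp (-|w|²)` with respect to
Lebesgue measure on `ℂ` (so that `𝔼 |W|² = 1`). -/
noncomputable def stdComplexGaussian : Measure ℂ :=
  (volume : Measure ℂ).withDensity (fun w => ENNReal.ofReal (Real.pi⁻¹ * Real.exp (-‖w‖ ^ 2)))

/-- The density above is normalised. -/
instance isProbabilityMeasure_stdComplexGaussian : IsProbabilityMeasure stdComplexGaussian := by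
  have hint : ∫ w : ℂ, Real.exp (-‖w‖ ^ 2) = Real.pi := by
    have h := Complex.integral_exp_neg_rpow (p := 2) (by norm_num)
    simpa [one_add_one_eq_two, Real.Gamma_two] using h
  have hi : Integrable (fun w : ℂ => Real.exp (-‖w‖ ^ 2)) := by
    by_contra hn
    rw [integral_undef hn] at hint
    exact Real.pi_ne_zero hint.symm
  constructor
  rw [stdComplexGaussian, withDensity_apply _ MeasurableSet.univ, Measure.restrict_univ,
    ← ofReal_integral_eq_lintegral_ofReal (hi.const_mul _)
      (Filter.Eventually.of_forall fun w => by positivity),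
    integral_const_mul, hint, inv_mul_cancel₀ Real.pi_ne_zero, ENNReal.ofReal_one]

section Hardcore

open scoped Classical in
/-- The hardcore partition function of a finite graph `G` with complex vertex fugacities `x`:
the sum of `∏ v ∈ I, x v` over all independent sets `I` of `G`. -/
noncomputable def hardcoreZ {V : Type*} [Fintype V] (G : SimpleGraph V) (x : V → ℂ) : ℂ :=
  ∑ I ∈ (Finset.univ : Finset (Finset V)).filter (fun I => G.IsIndepSet (I : Set V)),
    ∏ v ∈ I, x v

/-- The first-order term `L₁(x) = ∑ v, x v`. -/
noncomputable def clusterL1 {V : Type*} [Fintype V] (x : V → ℂ) : ℂ :=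
  ∑ v, x v

open scoped Classical in
/-- The second-order term `L₂(x) = -½ ∑ v, (x v)² - ∑_{u ∼ v} x u * x v`, the second sum being over
the edges of `G`, i.e. over unordered pairs of adjacent vertices. -/
noncomputable def clusterL2 {V : Type*} [Fintype V] (G : SimpleGraph V) (x : V → ℂ) : ℂ :=
  -(1 / 2) * ∑ v, x v ^ 2 - ∑ p ∈ G.edgeFinset, (p.map x).mul

/-- The second-order reweighting `F⁽²⁾(x) = Z_G(x) exp (-L₁(x) - L₂(x))`. -/
noncomputable def hardcoreF2 {V : Type*} [Fintype V] (G : SimpleGraph V) (x : V → ℂ) : ℂ :=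
  hardcoreZ G x * Complex.exp (-clusterL1 x - clusterL2 G x)

end Hardcore

/-- The line graph `L(K_{n,n})` on the vertex set `[n] × [n]`: the pair `(i, j)` stands for the edge
of `K_{n,n}` that joins row `i` to column `j`, and two distinct pairs are adjacent iff they share a
row or a column. -/
def lineGraphKnn (n : ℕ) : SimpleGraph (Fin n × Fin n) where
  Adj e f := e ≠ f ∧ (e.1 = f.1 ∨ e.2 = f.2)
  symm := ⟨fun _ _ h => ⟨h.1.symm, h.2.imp Eq.symm Eq.symm⟩⟩
  loopless := ⟨fun _ h => h.1 rfl⟩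

/-- `lineGraphKnn n` is the line graph of the complete bipartite graph `K_{n,n}`. -/
theorem lineGraphKnn_iso_lineGraph (n : ℕ) :
    Nonempty (lineGraphKnn n ≃g (completeBipartiteGraph (Fin n) (Fin n)).lineGraph) := by
  let f : Fin n × Fin n → (completeBipartiteGraph (Fin n) (Fin n)).edgeSet :=
    fun e => ⟨s(Sum.inl e.1, Sum.inr e.2), by simp⟩
  have hf : Function.Bijective f := by
    constructor
    · rintro ⟨a, b⟩ ⟨c, d⟩ h
      simpa [f] using h
    · rintro ⟨p, hp⟩
      induction p using Sym2.ind with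
      | _ u v =>
        rcases u with a | a <;> rcases v with b | b
        · simp at hp
        · exact ⟨(a, b), rfl⟩
        · exact ⟨(b, a), Subtype.ext Sym2.eq_swap⟩
        · simp at hp
  refine ⟨⟨Equiv.ofBijective f hf, ?_⟩⟩
  intro a b
  rw [SimpleGraph.lineGraph_adj_iff_exists]
  change (f a ≠ f b ∧ _) ↔ (a ≠ b ∧ _)
  rw [hf.1.ne_iff]
  refine and_congr_right fun _ => ?_
  simp [f]

/-! Write `R i` and `C j` for the row and column sums of `x = zW`. Counting adjacent pairs row by
row and column by column gives `-L₂ = (∑ R² + ∑ C² - ∑ x²) / 2`, so `F⁽²⁾` is `decoupledF R C x`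
times `exp (-∑ x² / 2)`, where `decoupledF` also makes sense when `R`, `C`, `x` are unrelated. The
matching sum is a moment: under the functional `⟨f⟩ = f 0 + f' 0` the power `a ^ d` has value 1 for
`d ≤ 1` and 0 otherwise, so `Z = ⟨exp (∑ a i * b j * x (i, j))⟩`. The linear terms of `decoupledF`
recentre the variables: the exponent becomes `R² / 2 + (a - 1) R` for each row, the same for each
column, and `(a - 1)(b - 1) x` for each entry, with `⟨a - 1⟩ = 0`.

Holomorphy supplies the independence. For entire `f`, the mean value inequality and the invariance
of a Gaussian pair under rotation by `π / 4` give `𝔼|f(X, X)|² ≤ 𝔼|f(√2 X, √2 Y)|²`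
(`lintegral_diagonal_le`). Three uses make row sums, column sums, entries and the factor `exp (-∑ x²
/ 2)` independent, at the price of constant factors in the variances. The last factor costs only a
constant because `n² |z|⁴` is bounded.

The second moment of `decoupledF` is now an average over two replicas of the angles
(`lintegral_decoupledF_le`). The Gaussian integrals leave one kernel per vertex and an interaction
`exp (t U V)`, with `U` a sum over rows and `V` a sum over columns. An auxiliary complex Gaussian
`ζ` linearises it, and the integral factorises into powers of `siteFactor`. With `s` of order
`n|z|²` and `t` of order `|z|²`, the terms of order `s²` in `siteFactor` cancel, and it is bounded
by `exp (O(s³ + s|u| + |u|²))`, where `|u| = √t |ζ|` (`norm_siteFactor_le`). As `n t ≤ s` is small,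
the `ζ`-integral converges and the second moment is at most `K exp (C n⁴|z|⁶)`.

It remains to remove `K`. Since `F⁽²⁾ - 1` vanishes to third order at the origin
(`hardcoreF2_sub_one_isBigO`), `𝔼|F⁽²⁾ - 1|²` decays like `|z|⁶` below any fixed scale. Comparing
with the scale at which `n⁴ r⁶` equals a constant turns the bound `K` there into `1 + O(n⁴|z|⁶)` for
small `z`, while for larger `z` the constant is absorbed in the exponential. -/

open Complex ComplexConjugate

/-! ### Exponential integrals against the complex Gaussian -/

theorem integral_stdComplexGaussian (f : ℂ → ℂ) :
    ∫ w, f w ∂stdComplexGaussian =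
      ∫ w : ℂ, ((Real.pi⁻¹ * Real.exp (-‖w‖ ^ 2) : ℝ) : ℂ) * f w := by
  rw [stdComplexGaussian, integral_withDensity_eq_integral_toReal_smul (by fun_prop)
    (Filter.Eventually.of_forall fun _ => ENNReal.ofReal_lt_top)]
  refine integral_congr_ae (Filter.Eventually.of_forall fun w => ?_)
  simp only
  rw [ENNReal.toReal_ofReal (by positivity), Complex.real_smul]

theorem integrable_stdComplexGaussian_iff {f : ℂ → ℝ} :
    Integrable f stdComplexGaussian ↔
      Integrable (fun w : ℂ => Real.pi⁻¹ * Real.exp (-‖w‖ ^ 2) * f w) := by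
  rw [stdComplexGaussian, integrable_withDensity_iff (by fun_prop)
    (Filter.Eventually.of_forall fun _ => ENNReal.ofReal_lt_top)]
  refine integrable_congr (Filter.Eventually.of_forall fun w => ?_)
  simp only
  rw [ENNReal.toReal_ofReal (by positivity), mul_comm]

theorem integrable_exp_neg_mul_norm_sq {b : ℝ} (hb : 0 < b) :
    Integrable (fun w : ℂ => Real.exp (-b * ‖w‖ ^ 2)) := by
  have h := (GaussianFourier.integrable_cexp_neg_mul_sq_norm_add (V := ℂ) (b := b) (by simpa) 0 0).norm
  refine h.congr (Filter.Eventually.of_forall fun w => ?_)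
  simp [Complex.norm_exp, ← Complex.ofReal_pow]

/-- Exponentials of subcritical quadratic growth are integrable for the complex Gaussian law. -/
theorem integrable_exp_quadratic_norm {q : ℝ} (hq : q < 1) (c : ℝ) :
    Integrable (fun w : ℂ => Real.exp (q * ‖w‖ ^ 2 + c * ‖w‖)) stdComplexGaussian := by
  rw [integrable_stdComplexGaussian_iff]
  -- Half of the gap `1 - q` absorbs the linear term by completing the square; the other half keeps
  -- the decay.
  set d := (1 - q) / 2 with hd
  have hd0 : 0 < d := by rw [hd]; linarith
  refine ((integrable_exp_neg_mul_norm_sq hd0).const_mul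
    (Real.pi⁻¹ * Real.exp (c ^ 2 / (4 * d)))).mono' (by fun_prop)
    (Filter.Eventually.of_forall fun w => ?_)
  rw [Real.norm_of_nonneg (by positivity), mul_assoc, mul_assoc, ← Real.exp_add, ← Real.exp_add]
  refine mul_le_mul_of_nonneg_left (Real.exp_le_exp.2 ?_) (by positivity)
  have h : c ^ 2 / (4 * d) + -d * ‖w‖ ^ 2 - (-‖w‖ ^ 2 + (q * ‖w‖ ^ 2 + c * ‖w‖))
      = (c - 2 * d * ‖w‖) ^ 2 / (4 * d) := by
    have : q = 1 - 2 * d := by rw [hd]; ring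
    rw [this]; field_simp; ring
  have := div_nonneg (sq_nonneg (c - 2 * d * ‖w‖)) (by positivity : 0 ≤ 4 * d)
  linarith

theorem integral_cexp_quadratic_real {b : ℝ} (hb : 0 < b) (c : ℂ) :
    ∫ x : ℝ, cexp (-b * x ^ 2 + c * x) = (√(Real.pi / b) : ℝ) * cexp (c ^ 2 / (4 * b)) := by
  have h := integral_cexp_quadratic (b := -b) (by simpa) c 0
  simp only [add_zero] at h
  rw [h, Real.sqrt_eq_rpow, Complex.ofReal_cpow (by positivity)]
  congr 1
  · simp
  · congr 1
    have : (b : ℂ) ≠ 0 := by exact_mod_cast hb.ne'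
    field_simp
    ring

/-- The Gaussian integral of the exponential of a circular-symmetric quadratic form. -/
theorem integral_cexp_quadratic_stdComplexGaussian {q : ℝ} (hq : |q| < 1) (l m : ℂ) :
    ∫ w, cexp (q / 2 * w ^ 2 + l * w + (q / 2 * conj w ^ 2 + m * conj w)) ∂stdComplexGaussian =
      ((√(1 - q ^ 2))⁻¹ : ℝ) * cexp ((l * m + q / 2 * (l ^ 2 + m ^ 2)) / (1 - q ^ 2)) := by
  obtain ⟨hq1, hq2⟩ := abs_lt.1 hq
  have hm : 0 < 1 - q := by linarith
  have hp : 0 < 1 + q := by linarith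
  rw [integral_stdComplexGaussian,
    ← Complex.volume_preserving_equiv_real_prod.symm.integral_comp
      (Complex.measurableEquivRealProd.symm.measurableEmbedding)]
  -- In real coordinates `-|w|² + q (w² + conj w²) / 2 = -(1 - q) u² - (1 + q) v²`, so the integral
  -- splits into two real ones.
  have key : ∀ p : ℝ × ℝ,
      ((Real.pi⁻¹ * Real.exp (-‖Complex.measurableEquivRealProd.symm p‖ ^ 2) : ℝ) : ℂ) *
        cexp (q / 2 * (Complex.measurableEquivRealProd.symm p) ^ 2
          + l * (Complex.measurableEquivRealProd.symm p)
          + (q / 2 * conj (Complex.measurableEquivRealProd.symm p) ^ 2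
            + m * conj (Complex.measurableEquivRealProd.symm p))) =
      (Real.pi⁻¹ : ℝ) * (cexp (-(1 - q : ℝ) * p.1 ^ 2 + (l + m) * p.1) *
        cexp (-(1 + q : ℝ) * p.2 ^ 2 + I * (l - m) * p.2)) := by
    rintro ⟨u, v⟩
    have h1 : Complex.measurableEquivRealProd.symm (u, v) = u + v * I := by
      apply Complex.ext <;> simp
    have h2 : ‖(u + v * I : ℂ)‖ ^ 2 = u ^ 2 + v ^ 2 := by
      rw [Complex.sq_norm, Complex.normSq_add_mul_I]
    rw [h1, h2, Complex.ofReal_mul, Complex.ofReal_exp, mul_assoc, ← Complex.exp_add,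
      ← Complex.exp_add]
    congr 2
    simp only [map_add, map_mul, conj_ofReal, conj_I]
    push_cast
    linear_combination (q - 0) * (v : ℂ) ^ 2 * I_sq
  rw [integral_congr_ae (Filter.Eventually.of_forall key), integral_const_mul]
  rw [Measure.volume_eq_prod, integral_prod_mul (fun u : ℝ => cexp (-(1 - q : ℝ) * u ^ 2 + (l + m) * u))
    (fun v : ℝ => cexp (-(1 + q : ℝ) * v ^ 2 + I * (l - m) * v)),
    integral_cexp_quadratic_real hm, integral_cexp_quadratic_real hp]
  rw [mul_mul_mul_comm, ← Complex.exp_add, ← mul_assoc, ← Complex.ofReal_mul, ← Complex.ofReal_mul]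
  congr 2
  · rw [← Real.sqrt_mul (by positivity), ← Real.sqrt_inv]
    rw [show Real.pi⁻¹ = √((Real.pi⁻¹) ^ 2) from (Real.sqrt_sq (by positivity)).symm,
      ← Real.sqrt_mul (by positivity)]
    congr 1
    have : 1 - q ^ 2 = (1 - q) * (1 + q) := by ring
    rw [this]
    field_simp
  · have h1 : (1 - q : ℂ) ≠ 0 := by exact_mod_cast hm.ne'
    have h2 : (1 + q : ℂ) ≠ 0 := by exact_mod_cast hp.ne'
    have h3 : (1 - q ^ 2 : ℂ) = (1 - q) * (1 + q) := by ring
    rw [h3]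
    push_cast
    field_simp
    linear_combination (2 * (l - m) ^ 2 * (1 - q)) * I_sq

theorem integral_cexp_linear_stdComplexGaussian (l m : ℂ) :
    ∫ w, cexp (l * w + m * conj w) ∂stdComplexGaussian = cexp (l * m) := by
  simpa using integral_cexp_quadratic_stdComplexGaussian (q := 0) (by simp) l m

/-! ### Laws and symmetries of complex Gaussian vectors -/

theorem charFun_stdComplexGaussian (t : ℂ) :
    charFun stdComplexGaussian t = cexp (-‖t‖ ^ 2 / 4) := by
  rw [charFun_apply]
  have h : ∀ w : ℂ, cexp (inner ℝ w t * I) = cexp (conj t * I / 2 * w + t * I / 2 * conj w) := by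
    intro w
    congr 1
    rw [Complex.inner, Complex.re_eq_add_conj]
    simp only [map_mul, conj_conj]
    ring
  simp_rw [h]
  rw [integral_cexp_linear_stdComplexGaussian]
  congr 1
  rw [← Complex.conj_mul']
  linear_combination (conj t * t / 4) * I_sq

/-- Real and imaginary parts have variance `1 / 2`. The identification gives access to the general
theory of Gaussian measures, in particular to their invariance under rotations of pairs. -/
theorem stdComplexGaussian_eq_map_stdGaussian :
    stdComplexGaussian = (stdGaussian ℂ).map (fun x => (√(1 / 2) : ℝ) • x) := by
  apply Measure.ext_of_charFun
  ext t
  rw [charFun_map_smul, charFun_stdGaussian, charFun_stdComplexGaussian]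
  congr 1
  rw [norm_smul, Real.norm_of_nonneg (Real.sqrt_nonneg _)]
  have h : ((√(1 / 2) : ℝ) : ℂ) ^ 2 = 1 / 2 := by
    rw [← Complex.ofReal_pow, Real.sq_sqrt (by norm_num)]; norm_num
  push_cast at h ⊢
  rw [mul_pow, h]
  ring

instance isGaussian_stdComplexGaussian : IsGaussian stdComplexGaussian := by
  rw [stdComplexGaussian_eq_map_stdGaussian]
  exact isGaussian_map (μ := stdGaussian ℂ) ((√(1 / 2) : ℝ) • ContinuousLinearMap.id ℝ ℂ)

theorem measurePreserving_mul_stdComplexGaussian {c : ℂ} (hc : ‖c‖ = 1) :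
    MeasurePreserving (fun w => c * w) stdComplexGaussian stdComplexGaussian := by
  refine ⟨by fun_prop, ?_⟩
  have : IsProbabilityMeasure (stdComplexGaussian.map (fun w => c * w)) :=
    Measure.isProbabilityMeasure_map (by fun_prop)
  apply Measure.ext_of_charFun
  ext t
  rw [charFun_stdComplexGaussian, charFun_apply, integral_map (by fun_prop) (by fun_prop)]
  have h : ∀ w : ℂ, inner ℝ (c * w) t = inner ℝ w (conj c * t) := by
    intro w
    simp only [Complex.inner, map_mul]
    congr 1
    ring
  simp_rw [h]
  rw [← charFun_apply, charFun_stdComplexGaussian]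
  simp [hc]

/-- The law of a finite family of independent standard complex Gaussian variables. -/
noncomputable abbrev stdComplexGaussianPi (ι : Type*) [Fintype ι] : Measure (ι → ℂ) :=
  Measure.pi fun _ => stdComplexGaussian

theorem measurePreserving_smul_stdComplexGaussianPi {ι : Type*} [Fintype ι] {c : ℂ}
    (hc : ‖c‖ = 1) :
    MeasurePreserving (fun x => c • x) (stdComplexGaussianPi ι) (stdComplexGaussianPi ι) :=
  measurePreserving_pi _ _ fun _ => measurePreserving_mul_stdComplexGaussian hc

instance isGaussian_stdComplexGaussianPi {ι : Type*} [Fintype ι] :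
    IsGaussian (stdComplexGaussianPi ι) := by
  have hind : iIndepFun (fun (i : ι) (x : ι → ℂ) => x i) (stdComplexGaussianPi ι) :=
    iIndepFun_pi (X := fun _ => id) (fun _ => aemeasurable_id)
  have h := hind.hasGaussianLaw fun i => by
    refine ⟨?_⟩
    rw [(measurePreserving_eval (fun _ : ι => stdComplexGaussian) i).map_eq]
    infer_instance
  simpa using! h.isGaussian_map

/-- Two independent standard complex Gaussian vectors are invariant under a rotation by `π / 4`. -/
theorem lintegral_rotation_stdComplexGaussianPi {ι : Type*} [Fintype ι]
    {g : (ι → ℂ) × (ι → ℂ) → ENNReal} (hg : Measurable g) :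
    ∫⁻ p, g ((√2 : ℂ) • p) ∂((stdComplexGaussianPi ι).prod (stdComplexGaussianPi ι)) =
      ∫⁻ p, g (p.1 + p.2, p.2 - p.1)
        ∂((stdComplexGaussianPi ι).prod (stdComplexGaussianPi ι)) := by
  -- The rotation invariance requires a centred law; centring comes from the symmetry `x ↦ -x`.
  have hodd : ∀ l : StrongDual ℝ (ι → ℂ), (stdComplexGaussianPi ι)[l] = 0 := by
    intro l
    have h : (stdComplexGaussianPi ι)[l] = ∫ x, l ((-1 : ℂ) • x) ∂stdComplexGaussianPi ι := by
      conv_lhs => rw [← (measurePreserving_smul_stdComplexGaussianPi (ι := ι) (c := -1)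
        (by simp)).map_eq]
      rw [integral_map (by fun_prop) (by fun_prop)]
    simp only [neg_smul, one_smul, map_neg, integral_neg] at h
    linarith
  have hrot := IsGaussian.map_rotation_eq_self_of_forall_strongDual_eq_zero hodd (Real.pi / 4)
  conv_lhs => rw [← hrot]
  rw [lintegral_map (by fun_prop) (by fun_prop)]
  refine lintegral_congr fun p => ?_
  congr 1
  have h2 : (√2 : ℂ) * (√2 : ℂ) = 2 := by
    rw [← Complex.ofReal_mul, Real.mul_self_sqrt (by norm_num)]; norm_num
  ext i
  · simp [ContinuousLinearMap.rotation_apply]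
    linear_combination (p.1 i + p.2 i) / 2 * h2
  · simp [ContinuousLinearMap.rotation_apply]
    linear_combination (p.2 i - p.1 i) / 2 * h2

theorem map_sum_stdComplexGaussianPi {κ : Type*} [Fintype κ] :
    (stdComplexGaussianPi κ).map (fun x => ∑ j, x j) =
      stdComplexGaussian.map (fun w => (√(Fintype.card κ) : ℝ) • w) := by
  have hind : iIndepFun (fun (j : κ) (x : κ → ℂ) => x j) (stdComplexGaussianPi κ) :=
    iIndepFun_pi (X := fun _ => id) (fun _ => aemeasurable_id)
  have := Measure.isProbabilityMeasure_map (μ := stdComplexGaussianPi κ)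
    (f := fun x => ∑ j, x j) (by fun_prop)
  have := Measure.isProbabilityMeasure_map (μ := stdComplexGaussian)
    (f := fun w => (√(Fintype.card κ) : ℝ) • w) (by fun_prop)
  apply Measure.ext_of_charFun
  rw [hind.charFun_map_fun_sum_eq_prod fun j => (measurable_pi_apply j).aemeasurable]
  ext t
  rw [charFun_map_smul]
  simp only [Finset.prod_apply,
    (measurePreserving_eval (fun _ : κ => stdComplexGaussian) _).map_eq, charFun_stdComplexGaussian]
  rw [Finset.prod_const, Finset.card_univ, ← Complex.exp_nat_mul, norm_smul,
    Real.norm_of_nonneg (Real.sqrt_nonneg _)]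
  congr 1
  rw [← Complex.ofReal_pow, ← Complex.ofReal_pow, mul_pow, Real.sq_sqrt (by positivity)]
  push_cast
  ring

/-- The row sums of a standard complex Gaussian matrix are independent complex Gaussian variables
of variance the number of columns. -/
theorem map_rowSum_stdComplexGaussianPi {ι κ : Type*} [Fintype ι] [Fintype κ] :
    (stdComplexGaussianPi (ι × κ)).map (fun x i => ∑ j, x (i, j)) =
      (stdComplexGaussianPi ι).map (fun w => (√(Fintype.card κ) : ℝ) • w) := by
  have h1 : (stdComplexGaussianPi (ι × κ)).map (MeasurableEquiv.curry ι κ ℂ) =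
      Measure.pi fun _ => stdComplexGaussianPi κ := by
    have := Measure.infinitePi_map_curry (fun (_ : ι) (_ : κ) => stdComplexGaussian)
    simpa only [Measure.infinitePi_eq_pi] using this
  have h2 : (fun (x : ι × κ → ℂ) i => ∑ j, x (i, j)) =
      (fun (y : ι → κ → ℂ) i => ∑ j, y i j) ∘ (MeasurableEquiv.curry ι κ ℂ) := rfl
  have h3 := Measure.pi_map_pi (μ := fun _ : ι => stdComplexGaussianPi κ)
    (f := fun _ y => ∑ j, y j) fun _ => by fun_prop
  rw [h2, ← Measure.map_map (by fun_prop) (by fun_prop), h1]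
  refine h3.trans ?_
  simp only [map_sum_stdComplexGaussianPi]
  exact (Measure.pi_map_pi (μ := fun _ : ι => stdComplexGaussian)
    (f := fun _ w => (√(Fintype.card κ) : ℝ) • w) fun _ => by fun_prop).symm

theorem map_colSum_stdComplexGaussianPi {ι κ : Type*} [Fintype ι] [Fintype κ] :
    (stdComplexGaussianPi (ι × κ)).map (fun x j => ∑ i, x (i, j)) =
      (stdComplexGaussianPi κ).map (fun w => (√(Fintype.card ι) : ℝ) • w) := by
  rw [← map_rowSum_stdComplexGaussianPi]
  have h := (measurePreserving_piCongrLeft (fun _ : κ × ι => stdComplexGaussian)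
    (Equiv.prodComm ι κ)).map_eq
  rw [stdComplexGaussianPi, stdComplexGaussianPi, ← h, Measure.map_map (by fun_prop) (by fun_prop)]
  rfl

/-! ### Circle averages, mean value inequality and decoupling -/

/-- The uniform law of the angle of a point of the unit circle. -/
noncomputable def angleMeasure : Measure ℝ :=
  ENNReal.ofReal (2 * Real.pi)⁻¹ • (volume : Measure ℝ).restrict (Set.Ioc 0 (2 * Real.pi))

instance isProbabilityMeasure_angleMeasure : IsProbabilityMeasure angleMeasure := by
  constructor
  have h : (0 : ℝ) < 2 * Real.pi := by positivity
  simp only [angleMeasure, Measure.smul_apply, Measure.restrict_apply_univ, Real.volume_Ioc,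
    sub_zero, smul_eq_mul]
  rw [← ENNReal.ofReal_mul (by positivity), inv_mul_cancel₀ h.ne', ENNReal.ofReal_one]

/-- The point of the unit circle of a given angle. -/
noncomputable abbrev unitPoint (θ : ℝ) : ℂ := circleMap 0 1 θ

theorem norm_unitPoint (θ : ℝ) : ‖unitPoint θ‖ = 1 := by simp [unitPoint]

theorem integral_angleMeasure_eq_circleAverage (f : ℂ → ℂ) :
    ∫ θ, f (unitPoint θ) ∂angleMeasure = Real.circleAverage f 0 1 := by
  have h : (0 : ℝ) ≤ 2 * Real.pi := by positivity
  rw [Real.circleAverage_def, intervalIntegral.integral_of_le h, angleMeasure,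
    integral_smul_measure, ENNReal.toReal_ofReal (by positivity)]

theorem integral_unitPoint_of_differentiable {f : ℂ → ℂ} (hf : Differentiable ℂ f) :
    ∫ θ, f (unitPoint θ) ∂angleMeasure = f 0 := by
  rw [integral_angleMeasure_eq_circleAverage]
  exact (hf.diffContOnCl).circleAverage

theorem enorm_integral_sq_le_lintegral {α : Type*} [MeasurableSpace α] {μ : Measure α}
    [IsProbabilityMeasure μ] {f : α → ℂ} (hf : AEStronglyMeasurable f μ) :
    ‖∫ x, f x ∂μ‖ₑ ^ 2 ≤ ∫⁻ x, ‖f x‖ₑ ^ 2 ∂μ := by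
  have h1 : ‖∫ x, f x ∂μ‖ₑ ≤ eLpNorm f 1 μ := by
    rw [eLpNorm_one_eq_lintegral_enorm]
    exact enorm_integral_le_lintegral_enorm f
  have h2 : eLpNorm f 1 μ ≤ eLpNorm f 2 μ :=
    eLpNorm_le_eLpNorm_of_exponent_le (by norm_num) hf
  have h3 := eLpNorm_nnreal_pow_eq_lintegral (μ := μ) (f := f) (p := 2) (by norm_num)
  simp only [NNReal.coe_ofNat, ENNReal.rpow_ofNat, ENNReal.coe_ofNat] at h3
  rw [← h3]
  gcongr
  exact h1.trans h2

theorem enorm_sq_le_lintegral_circle {f : ℂ → ℂ} (hf : Differentiable ℂ f) :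
    ‖f 0‖ₑ ^ 2 ≤ ∫⁻ θ, ‖f (unitPoint θ)‖ₑ ^ 2 ∂angleMeasure := by
  rw [← integral_unitPoint_of_differentiable hf]
  exact enorm_integral_sq_le_lintegral
    (hf.continuous.comp (continuous_circleMap 0 1)).aestronglyMeasurable

/-- Averaging a function of a Gaussian vector over the multiplication by a point of the
unit circle does not change its integral. -/
theorem lintegral_lintegral_unitPoint_smul {ι : Type*} [Fintype ι] {g : (ι → ℂ) → ENNReal}
    (hg : Measurable g) :
    ∫⁻ x, ∫⁻ θ, g (unitPoint θ • x) ∂angleMeasure ∂stdComplexGaussianPi ι =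
      ∫⁻ x, g x ∂stdComplexGaussianPi ι := by
  rw [lintegral_lintegral_swap]
  · have h : ∀ θ, ∫⁻ x, g (unitPoint θ • x) ∂stdComplexGaussianPi ι =
        ∫⁻ x, g x ∂stdComplexGaussianPi ι := fun θ =>
      (measurePreserving_smul_stdComplexGaussianPi (norm_unitPoint θ)).lintegral_comp hg
    simp [h]
  · have : Measurable fun p : (ι → ℂ) × ℝ => g (unitPoint p.2 • p.1) :=
      hg.comp (((continuous_circleMap 0 1).comp continuous_snd).smul continuous_fst).measurable
    exact this.aemeasurable

/-- The mean value inequality for entire functions of a Gaussian vector. -/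
theorem enorm_sq_le_lintegral_stdComplexGaussianPi {ι : Type*} [Fintype ι] {h : (ι → ℂ) → ℂ}
    (hh : Differentiable ℂ h) :
    ‖h 0‖ₑ ^ 2 ≤ ∫⁻ x, ‖h x‖ₑ ^ 2 ∂stdComplexGaussianPi ι := by
  have hm : Measurable h := hh.continuous.measurable
  rw [← lintegral_lintegral_unitPoint_smul (by fun_prop)]
  calc ‖h 0‖ₑ ^ 2 = ∫⁻ _, ‖h 0‖ₑ ^ 2 ∂stdComplexGaussianPi ι := by simp
    _ ≤ _ := lintegral_mono fun x => by
      have := enorm_sq_le_lintegral_circle (f := fun z => h (z • x)) (by fun_prop)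
      simpa using this

/-- Decoupling: restricting an entire function to the diagonal decreases its Gaussian `L²` norm,
up to doubling the variance. -/
theorem lintegral_diagonal_le {ι : Type*} [Fintype ι] {f : (ι → ℂ) → (ι → ℂ) → ℂ}
    (hf : Differentiable ℂ fun p : (ι → ℂ) × (ι → ℂ) => f p.1 p.2) :
    ∫⁻ x, ‖f x x‖ₑ ^ 2 ∂stdComplexGaussianPi ι ≤
      ∫⁻ x, ∫⁻ y, ‖f ((√2 : ℂ) • x) ((√2 : ℂ) • y)‖ₑ ^ 2
        ∂stdComplexGaussianPi ι ∂stdComplexGaussianPi ι := by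
  have hm : Measurable fun p : (ι → ℂ) × (ι → ℂ) => f p.1 p.2 := hf.continuous.measurable
  have hg : Measurable fun p : (ι → ℂ) × (ι → ℂ) => ‖f p.1 p.2‖ₑ ^ 2 := by fun_prop
  have h1 := lintegral_rotation_stdComplexGaussianPi hg
  have hm1 : Measurable fun p : (ι → ℂ) × (ι → ℂ) =>
      ‖f ((√2 : ℂ) • p).1 ((√2 : ℂ) • p).2‖ₑ ^ 2 := hg.comp (measurable_const_smul _)
  have hm2 : Measurable fun p : (ι → ℂ) × (ι → ℂ) => ‖f (p.1 + p.2) (p.2 - p.1)‖ₑ ^ 2 :=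
    hg.comp (g := fun p : (ι → ℂ) × (ι → ℂ) => ‖f p.1 p.2‖ₑ ^ 2)
      (f := fun p : (ι → ℂ) × (ι → ℂ) => (p.1 + p.2, p.2 - p.1)) (by fun_prop)
  rw [lintegral_prod _ hm1.aemeasurable, lintegral_prod_symm _ hm2.aemeasurable] at h1
  refine le_trans ?_ h1.ge
  refine lintegral_mono fun y => ?_
  -- For fixed `y` this function of `x` is entire and takes the diagonal value `f y y` at `x = 0`;
  -- the pair `(x + y, y - x)` is `√2` times a rotation of `(x, y)`.
  have := enorm_sq_le_lintegral_stdComplexGaussianPi (h := fun x => f (x + y) (y - x))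
    (hf.comp (g := fun p : (ι → ℂ) × (ι → ℂ) => f p.1 p.2)
      (f := fun x : ι → ℂ => (x + y, y - x)) (by fun_prop))
  simpa using this

/-! ### Entire functions vanishing to third order -/

/-- An entire function vanishing to order three at the origin factors through the cube. -/
theorem exists_eq_pow_three_mul {f : ℂ → ℂ} (hf : Differentiable ℂ f)
    (h0 : f =O[nhds 0] fun z => z ^ 3) :
    ∃ g : ℂ → ℂ, Differentiable ℂ g ∧ ∀ z, f z = z ^ 3 * g z := by
  have step : ∀ (k : ℕ) (f : ℂ → ℂ), Differentiable ℂ f → (f =O[nhds 0] fun z => z ^ (k + 1)) →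
      ∃ g : ℂ → ℂ, Differentiable ℂ g ∧ (∀ z, f z = z * g z) ∧
        (g =O[nhds 0] fun z => z ^ k) := by
    intro k f hf hO
    have hf0 : f 0 = 0 := by
      refine Asymptotics.IsBigO.eq_zero_of_norm_pow (x₀ := 0) (n := k + 1) ?_ (by omega)
      simpa only [sub_zero, ← norm_pow] using hO.norm_right
    have hg : Differentiable ℂ (dslope f 0) := by
      rw [← differentiableOn_univ, Complex.differentiableOn_dslope Filter.univ_mem]
      exact hf.differentiableOn
    refine ⟨dslope f 0, hg, fun z => ?_, ?_⟩
    · have := sub_smul_dslope f 0 z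
      simpa [hf0] using this.symm
    · obtain ⟨C, hC⟩ := hO.bound
      have hne : ∀ᶠ z in nhdsWithin (0 : ℂ) {0}ᶜ, ‖dslope f 0 z‖ ≤ C * ‖z ^ k‖ := by
        filter_upwards [hC.filter_mono nhdsWithin_le_nhds, self_mem_nhdsWithin] with z hz hz0
        have hpos : 0 < ‖z‖ := norm_pos_iff.2 hz0
        rw [dslope_of_ne _ hz0, slope_def_field, hf0, sub_zero, sub_zero, norm_div,
          div_le_iff₀ hpos]
        rwa [pow_succ, norm_mul, ← mul_assoc] at hz
      -- At the origin the quotient is a derivative, so the estimate there is obtained by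
      -- continuity.
      have hat : ‖dslope f 0 0‖ ≤ C * ‖(0 : ℂ) ^ k‖ := by
        refine le_of_tendsto_of_tendsto
          ((hg.continuous.norm.tendsto 0).mono_left nhdsWithin_le_nhds) ?_ hne
        have : Continuous fun z : ℂ => C * ‖z ^ k‖ := by fun_prop
        exact (this.tendsto 0).mono_left nhdsWithin_le_nhds
      refine Asymptotics.IsBigO.of_bound C ?_
      rw [eventually_nhdsWithin_iff] at hne
      filter_upwards [hne] with z hz
      by_cases h : z = 0
      · rw [h]; exact hat
      · exact hz h
  obtain ⟨g1, hg1, e1, o1⟩ := step 2 f hf h0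
  obtain ⟨g2, hg2, e2, o2⟩ := step 1 g1 hg1 o1
  obtain ⟨g3, hg3, e3, o3⟩ := step 0 g2 hg2 o2
  exact ⟨g3, hg3, fun z => by rw [e1, e2, e3]; ring⟩

/-- An `L²` form of the Schwarz lemma. Write `f = z³ g` and represent `g z` by Cauchy's formula on
the unit circle: there `|g| = |f|`, and the kernel `a / (a - z)` is at most 2 because `|z| ≤ 1 / 2`.
Jensen's inequality gives the factor 4. -/
theorem enorm_sq_le_of_isBigO_pow_three {f : ℂ → ℂ} (hf : Differentiable ℂ f)
    (h0 : f =O[nhds 0] fun z => z ^ 3) {z : ℂ} (hz : ‖z‖ ≤ 1 / 2) :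
    ‖f z‖ₑ ^ 2 ≤ ENNReal.ofReal (4 * ‖z‖ ^ 6) *
      ∫⁻ θ, ‖f (unitPoint θ)‖ₑ ^ 2 ∂angleMeasure := by
  obtain ⟨g, hg, hfg⟩ := exists_eq_pow_three_mul hf h0
  have hne : ∀ θ, unitPoint θ - z ≠ 0 := fun θ h => by
    have := norm_unitPoint θ
    rw [sub_eq_zero.1 h] at this
    linarith
  have hmean : ∫ θ, unitPoint θ / (unitPoint θ - z) * g (unitPoint θ) ∂angleMeasure = g z := by
    rw [integral_angleMeasure_eq_circleAverage (fun w => w / (w - z) * g w)]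
    have := (hg.diffContOnCl (s := Metric.ball 0 |1|)).circleAverage_smul_div (c := 0) (R := 1)
      (w := z) (by simp; linarith)
    simpa using this
  have hcont : Continuous fun θ => unitPoint θ / (unitPoint θ - z) * g (unitPoint θ) :=
    ((continuous_circleMap 0 1).div ((continuous_circleMap 0 1).sub continuous_const) hne).mul
      (hg.continuous.comp (continuous_circleMap 0 1))
  have h1 := enorm_integral_sq_le_lintegral (μ := angleMeasure) hcont.aestronglyMeasurable
  rw [hmean] at h1
  have h2 : ∀ θ, ‖unitPoint θ / (unitPoint θ - z) * g (unitPoint θ)‖ₑ ^ 2 ≤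
      ENNReal.ofReal 4 * ‖f (unitPoint θ)‖ₑ ^ 2 := by
    intro θ
    rw [hfg, ← ofReal_norm, ← ofReal_norm, ← ENNReal.ofReal_pow (by positivity),
      ← ENNReal.ofReal_pow (by positivity), ← ENNReal.ofReal_mul (by norm_num)]
    refine ENNReal.ofReal_le_ofReal ?_
    rw [norm_mul, norm_mul, norm_div, norm_pow, norm_unitPoint]
    have h3 : 1 / 2 ≤ ‖unitPoint θ - z‖ := by
      have := norm_sub_norm_le (unitPoint θ) z
      rw [norm_unitPoint] at this
      linarith
    have h4 : 1 / ‖unitPoint θ - z‖ ≤ 2 := by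
      rw [div_le_iff₀ (by linarith)]; linarith
    have h5 : (1 / ‖unitPoint θ - z‖) ^ 2 ≤ 2 ^ 2 := by gcongr
    nlinarith [mul_le_mul_of_nonneg_right h5 (sq_nonneg ‖g (unitPoint θ)‖)]
  have h3 := h1.trans ((lintegral_mono h2).trans_eq (lintegral_const_mul' _ _ ENNReal.ofReal_ne_top))
  rw [hfg z, enorm_mul, mul_pow, mul_comm 4, ENNReal.ofReal_mul (by positivity), mul_assoc]
  refine mul_le_mul' (le_of_eq ?_) h3
  rw [← ofReal_norm, ← ENNReal.ofReal_pow (by positivity), norm_pow]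
  ring_nf

/-- Gaussian second moments of an entire function vanishing to third order decay at least like the
cube of the variance. -/
theorem lintegral_smul_le_of_isBigO_pow_three {ι : Type*} [Fintype ι] {h : (ι → ℂ) → ℂ}
    (hh : Differentiable ℂ h) (h0 : h =O[nhds 0] fun x => ‖x‖ ^ 3) {r : ℝ} (hr : 0 < r) {z : ℂ}
    (hz : ‖z‖ ≤ r / 2) :
    ∫⁻ x, ‖h (z • x)‖ₑ ^ 2 ∂stdComplexGaussianPi ι ≤
      ENNReal.ofReal (4 * (‖z‖ / r) ^ 6) *
        ∫⁻ x, ‖h ((r : ℂ) • x)‖ₑ ^ 2 ∂stdComplexGaussianPi ι := by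
  have hm : Measurable h := hh.continuous.measurable
  have hr' : (r : ℂ) ≠ 0 := by exact_mod_cast hr.ne'
  rw [← lintegral_lintegral_unitPoint_smul (g := fun x => ‖h ((r : ℂ) • x)‖ₑ ^ 2) (by fun_prop),
    ← lintegral_const_mul' _ _ ENNReal.ofReal_ne_top]
  refine lintegral_mono fun x => ?_
  have hO : (fun w : ℂ => h ((r : ℂ) • w • x)) =O[nhds 0] fun w => w ^ 3 := by
    have ht : Filter.Tendsto (fun w : ℂ => (r : ℂ) • w • x) (nhds 0) (nhds 0) := by
      have : Continuous fun w : ℂ => (r : ℂ) • w • x := by fun_prop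
      simpa using this.tendsto 0
    refine (h0.comp_tendsto ht).trans ?_
    refine Asymptotics.IsBigO.of_bound (r ^ 3 * ‖x‖ ^ 3) (Filter.Eventually.of_forall fun w => ?_)
    simp only [Function.comp, norm_smul, norm_pow, norm_mul, Complex.norm_real,
      Real.norm_eq_abs, abs_of_pos hr, abs_norm]
    apply le_of_eq; ring
  have hzr : ‖z / r‖ = ‖z‖ / r := by simp [abs_of_pos hr]
  have := enorm_sq_le_of_isBigO_pow_three (f := fun w : ℂ => h ((r : ℂ) • w • x)) (by fun_prop) hO
    (z := z / r) (by rw [hzr, div_le_iff₀ hr]; linarith)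
  rwa [hzr, smul_smul, mul_div_cancel₀ _ hr'] at this

/-! ### The functional `f ↦ f 0 + deriv f 0` as a circle average -/

theorem conj_unitPoint (θ : ℝ) : conj (unitPoint θ) = (unitPoint θ)⁻¹ := by
  rw [Complex.inv_def, Complex.normSq_eq_norm_sq, norm_unitPoint]; simp

theorem unitPoint_ne_zero (θ : ℝ) : unitPoint θ ≠ 0 := by
  rw [← norm_ne_zero_iff, norm_unitPoint]; exact one_ne_zero

theorem continuous_unitPoint : Continuous unitPoint := continuous_circleMap 0 1

/-- The weight that turns the average over the unit circle into the functional
`f ↦ f 0 + deriv f 0`. -/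
noncomputable def unitWeight (θ : ℝ) : ℂ := 1 + conj (unitPoint θ)

theorem continuous_unitWeight : Continuous unitWeight :=
  continuous_const.add (Complex.continuous_conj.comp continuous_unitPoint)

theorem norm_unitWeight_le (θ : ℝ) : ‖unitWeight θ‖ ≤ 2 := by
  refine (norm_add_le _ _).trans ?_
  rw [RCLike.norm_conj, norm_unitPoint, norm_one]; norm_num

theorem integrable_angleMeasure_of_continuous {f : ℝ → ℂ} (hf : Continuous f) :
    Integrable f angleMeasure := by
  have h : IntegrableOn f (Set.Ioc 0 (2 * Real.pi)) :=
    (hf.integrableOn_Icc).mono_set Set.Ioc_subset_Icc_self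
  exact h.integrable.smul_measure ENNReal.ofReal_ne_top

/-- On the circle `conj a * f a = dslope f 0 a + conj a * f 0`. The first term averages to the
derivative at the origin, the second to zero. -/
theorem integral_unitWeight_mul {f : ℂ → ℂ} (hf : Differentiable ℂ f) :
    ∫ θ, unitWeight θ * f (unitPoint θ) ∂angleMeasure = f 0 + deriv f 0 := by
  have hd : Differentiable ℂ (dslope f 0) := by
    rw [← differentiableOn_univ, Complex.differentiableOn_dslope Filter.univ_mem]
    exact hf.differentiableOn
  have key : ∀ θ, unitWeight θ * f (unitPoint θ) =
      (f (unitPoint θ) + dslope f 0 (unitPoint θ)) + conj (unitPoint θ) * f 0 := by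
    intro θ
    have h := sub_smul_dslope f 0 (unitPoint θ)
    rw [sub_zero, smul_eq_mul] at h
    rw [unitWeight, conj_unitPoint]
    have h0 := unitPoint_ne_zero θ
    field_simp
    linear_combination -h
  have hconj : ∫ θ, conj (unitPoint θ) ∂angleMeasure = 0 := by
    rw [integral_conj, integral_unitPoint_of_differentiable (f := fun z => z) (by fun_prop)]
    simp
  have hi1 : Integrable (fun θ => f (unitPoint θ)) angleMeasure :=
    integrable_angleMeasure_of_continuous (hf.continuous.comp continuous_unitPoint)
  have hi2 : Integrable (fun θ => dslope f 0 (unitPoint θ)) angleMeasure :=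
    integrable_angleMeasure_of_continuous (hd.continuous.comp continuous_unitPoint)
  have hi3 : Integrable (fun θ => conj (unitPoint θ)) angleMeasure :=
    integrable_angleMeasure_of_continuous (Complex.continuous_conj.comp continuous_unitPoint)
  simp only [key]
  rw [integral_add (hi1.fun_add hi2) (hi3.mul_const _), integral_add hi1 hi2,
    integral_unitPoint_of_differentiable hf, integral_unitPoint_of_differentiable hd,
    integral_mul_const, hconj, zero_mul, add_zero, dslope_same]

/-- The same functional after the reflection `a ↦ a⁻¹`; it serves the conjugated replica in second
moments. -/
theorem integral_conj_unitWeight_mul {f : ℂ → ℂ} (hf : Differentiable ℂ f) :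
    ∫ θ, conj (unitWeight θ) * f (conj (unitPoint θ)) ∂angleMeasure = f 0 + deriv f 0 := by
  rw [← integral_unitWeight_mul hf]
  have h1 : ∀ θ, conj (unitWeight θ) * f (conj (unitPoint θ)) =
      (fun z : ℂ => (1 + z⁻¹) * f z) (unitPoint θ)⁻¹ := by
    intro θ
    simp [unitWeight, conj_unitPoint]
  have h2 : ∀ θ, unitWeight θ * f (unitPoint θ) =
      (fun z : ℂ => (1 + z⁻¹) * f z) (unitPoint θ) := by
    intro θ
    simp [unitWeight, conj_unitPoint]
  simp only [h1, h2]
  rw [integral_angleMeasure_eq_circleAverage (fun z : ℂ => (1 + z⁻¹) * f z),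
    integral_angleMeasure_eq_circleAverage (fun z : ℂ => (fun z : ℂ => (1 + z⁻¹) * f z) z⁻¹)]
  exact Real.circleAverage_zero_one_congr_inv (f := fun z : ℂ => (1 + z⁻¹) * f z)

/-- Independent uniform angles. -/
noncomputable abbrev anglePi (ι : Type*) [Fintype ι] : Measure (ι → ℝ) :=
  Measure.pi fun _ => angleMeasure

/-- The moments `⟨a ^ d * exp (a * r)⟩` of the functional `f ↦ f 0 + deriv f 0`. -/
noncomputable def monomerWeight (d : ℕ) (r : ℂ) : ℂ :=
  if d = 0 then 1 + r else if d = 1 then 1 else 0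

theorem integral_unitWeight_mul_pow_mul_exp (d : ℕ) (r : ℂ) :
    ∫ θ, unitWeight θ * (unitPoint θ ^ d * cexp (unitPoint θ * r)) ∂angleMeasure =
      monomerWeight d r := by
  rw [integral_unitWeight_mul (f := fun z => z ^ d * cexp (z * r)) (by fun_prop)]
  have h : HasDerivAt (fun z : ℂ => z ^ d * cexp (z * r))
      ((d * (0 : ℂ) ^ (d - 1)) * cexp (0 * r) + 0 ^ d * (cexp (0 * r) * (1 * r))) 0 :=
    (hasDerivAt_pow d (0 : ℂ)).mul ((hasDerivAt_id (0 : ℂ)).mul_const r).cexp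
  rw [h.deriv, monomerWeight]
  rcases d with _ | _ | d
  · simp
  · simp
  · simp

/-- Only the value and the derivative at the origin of an exponential matter, so it may be
replaced by a product of linear factors. -/
theorem integral_unitWeight_mul_exp_eq_prod {κ : Type*} [Fintype κ] (r : ℂ) (y : κ → ℂ) :
    ∫ θ, unitWeight θ * cexp (unitPoint θ * (r + ∑ j, y j)) ∂angleMeasure =
      ∫ θ, unitWeight θ * (cexp (unitPoint θ * r) * ∏ j, (1 + unitPoint θ * y j))
        ∂angleMeasure := by
  rw [integral_unitWeight_mul (f := fun z => cexp (z * (r + ∑ j, y j))) (by fun_prop),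
    integral_unitWeight_mul (f := fun z => cexp (z * r) * ∏ j, (1 + z * y j)) (by fun_prop)]
  have h1 : HasDerivAt (fun z : ℂ => cexp (z * (r + ∑ j, y j)))
      (cexp (0 * (r + ∑ j, y j)) * (1 * (r + ∑ j, y j))) 0 :=
    ((hasDerivAt_id (0 : ℂ)).mul_const _).cexp
  classical
  have h2 : HasDerivAt (fun z : ℂ => ∏ j, (1 + z * y j))
      (∑ i, (∏ j ∈ Finset.univ.erase i, (1 + 0 * y j)) • (1 * y i)) 0 :=
    HasDerivAt.fun_finsetProd fun i _ => ((hasDerivAt_id (0 : ℂ)).mul_const _).const_add 1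
  have h3 := (((hasDerivAt_id (0 : ℂ)).mul_const r).cexp).mul h2
  have h3' : HasDerivAt (fun z : ℂ => cexp (z * r) * ∏ j, (1 + z * y j)) _ 0 := h3
  rw [h1.deriv, h3'.deriv]
  simp

/-- The product of the weights of finitely many angles. -/
noncomputable def angleWeight {ι : Type*} [Fintype ι] (θ : ι → ℝ) : ℂ := ∏ i, unitWeight (θ i)

theorem continuous_angleWeight {ι : Type*} [Fintype ι] :
    Continuous (angleWeight : (ι → ℝ) → ℂ) :=
  continuous_finsetProd _ fun i _ => continuous_unitWeight.comp (continuous_apply i)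

theorem integrable_prod_angle {ι : Type*} [Fintype ι] {f : ι → ℝ → ℂ}
    (hf : ∀ i, Continuous (f i)) :
    Integrable (fun θ : ι → ℝ => ∏ i, f i (θ i)) (anglePi ι) :=
  Integrable.fintype_prod fun i => integrable_angleMeasure_of_continuous (hf i)

theorem continuous_unitWeight_mul_pow_mul_exp (d : ℕ) (r : ℂ) :
    Continuous fun θ => unitWeight θ * (unitPoint θ ^ d * cexp (unitPoint θ * r)) :=
  continuous_unitWeight.mul ((continuous_unitPoint.pow d).mul
    (Complex.continuous_exp.comp (continuous_unitPoint.mul continuous_const)))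

/-! ### Circle representation of the monomer-dimer polynomial -/

/-- The number of elements of `I` in a given row. -/
def rowDeg {ι κ : Type*} [DecidableEq ι] (I : Finset (ι × κ)) (i : ι) : ℕ := (I.filter fun e => e.1 = i).card

/-- The number of elements of `I` in a given column. -/
def colDeg {ι κ : Type*} [DecidableEq κ] (I : Finset (ι × κ)) (j : κ) : ℕ := (I.filter fun e => e.2 = j).card

theorem prod_comp_fst_eq_pow {ι κ : Type*} [Fintype ι] [DecidableEq ι]
    (I : Finset (ι × κ)) (g : ι → ℂ) :
    ∏ e ∈ I, g e.1 = ∏ i, g i ^ rowDeg I i := by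
  rw [← Finset.prod_fiberwise I (fun e => e.1)]
  refine Finset.prod_congr rfl fun i _ => ?_
  rw [rowDeg, ← Finset.prod_const]
  exact Finset.prod_congr rfl fun e he => by rw [(Finset.mem_filter.1 he).2]

theorem prod_comp_snd_eq_pow {ι κ : Type*} [Fintype κ] [DecidableEq κ]
    (I : Finset (ι × κ)) (g : κ → ℂ) :
    ∏ e ∈ I, g e.2 = ∏ j, g j ^ colDeg I j := by
  rw [← Finset.prod_fiberwise I (fun e => e.2)]
  refine Finset.prod_congr rfl fun j _ => ?_
  rw [colDeg, ← Finset.prod_const]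
  exact Finset.prod_congr rfl fun e he => by rw [(Finset.mem_filter.1 he).2]

section MonomerDimer

variable {ι κ : Type*} [Fintype ι] [Fintype κ] [DecidableEq ι] [DecidableEq κ]

/-- The monomer-dimer polynomial of the complete bipartite graph, with edge weights `x`, and with
weights `1 + r i`, `1 + c j` at the vertices that are not covered. -/
noncomputable def monomerDimer (r : ι → ℂ) (c : κ → ℂ) (x : ι × κ → ℂ) : ℂ :=
  ∑ I : Finset (ι × κ), (∏ e ∈ I, x e) *
    ((∏ i, monomerWeight (rowDeg I i) (r i)) * ∏ j, monomerWeight (colDeg I j) (c j))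

/-- Averaging over the row angles alone imposes the matching condition on rows. The column variables
`b` stay free, to be replaced by points of the circle afterwards. -/
theorem integral_angleWeight_mul_exp_row (r : ι → ℂ) (x : ι × κ → ℂ) (b : κ → ℂ) :
    ∫ θ, angleWeight θ * cexp (∑ i, unitPoint (θ i) * (r i + ∑ j, x (i, j) * b j)) ∂anglePi ι =
      ∑ I : Finset (ι × κ), (∏ e ∈ I, x e) *
        ((∏ i, monomerWeight (rowDeg I i) (r i)) * ∏ j, b j ^ colDeg I j) := by
  have h1 : ∀ θ : ι → ℝ,
      angleWeight θ * cexp (∑ i, unitPoint (θ i) * (r i + ∑ j, x (i, j) * b j)) =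
        ∏ i, unitWeight (θ i) * cexp (unitPoint (θ i) * (r i + ∑ j, x (i, j) * b j)) := by
    intro θ
    rw [angleWeight, Complex.exp_sum, Finset.prod_mul_distrib]
  simp only [h1]
  rw [integral_fintype_prod_eq_prod
    (f := fun i θ => unitWeight θ * cexp (unitPoint θ * (r i + ∑ j, x (i, j) * b j)))]
  -- The functional sees only first-order jets, so the exponential becomes `∏ (1 + a x b)`, whose
  -- expansion is a finite sum over edge sets.
  simp only [integral_unitWeight_mul_exp_eq_prod]
  rw [← integral_fintype_prod_eq_prod (f := fun i θ => unitWeight θ *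
    (cexp (unitPoint θ * r i) * ∏ j, (1 + unitPoint θ * (x (i, j) * b j))))]
  have h2 : ∀ θ : ι → ℝ, (∏ i, unitWeight (θ i) *
      (cexp (unitPoint (θ i) * r i) * ∏ j, (1 + unitPoint (θ i) * (x (i, j) * b j)))) =
      ∑ I : Finset (ι × κ), ((∏ e ∈ I, x e) * ∏ j, b j ^ colDeg I j) *
        ∏ i, unitWeight (θ i) *
          (unitPoint (θ i) ^ rowDeg I i * cexp (unitPoint (θ i) * r i)) := by
    intro θ
    simp only [Finset.prod_mul_distrib]
    rw [← Fintype.prod_prod_type' (fun i j => 1 + unitPoint (θ i) * (x (i, j) * b j)),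
      Finset.prod_one_add, Finset.powerset_univ, Finset.mul_sum, Finset.mul_sum]
    refine Finset.sum_congr rfl fun I _ => ?_
    rw [Finset.prod_mul_distrib, Finset.prod_mul_distrib,
      prod_comp_fst_eq_pow I fun i => unitPoint (θ i), prod_comp_snd_eq_pow I b]
    ring
  simp only [h2]
  rw [integral_finsetSum]
  · refine Finset.sum_congr rfl fun I _ => ?_
    rw [integral_const_mul, integral_fintype_prod_eq_prod (f := fun i θ => unitWeight θ *
          (unitPoint θ ^ rowDeg I i * cexp (unitPoint θ * r i)))]
    simp only [integral_unitWeight_mul_pow_mul_exp]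
    ring
  · intro I _
    exact (integrable_prod_angle (f := fun i θ => unitWeight θ *
      (unitPoint θ ^ rowDeg I i * cexp (unitPoint θ * r i))) fun i =>
      continuous_unitWeight_mul_pow_mul_exp _ _).const_mul _

/-- The monomer-dimer polynomial as an average of exponentials over unit circles. -/
theorem integral_integral_exp_eq_monomerDimer (r : ι → ℂ) (c : κ → ℂ) (x : ι × κ → ℂ) :
    ∫ φ, ∫ θ, angleWeight θ * angleWeight φ *
      cexp ((∑ i, unitPoint (θ i) * r i) + (∑ j, unitPoint (φ j) * c j) +
        ∑ e, x e * (unitPoint (θ e.1) * unitPoint (φ e.2))) ∂anglePi ι ∂anglePi κ =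
      monomerDimer r c x := by
  have h1 : ∀ (φ : κ → ℝ) (θ : ι → ℝ), angleWeight θ * angleWeight φ *
      cexp ((∑ i, unitPoint (θ i) * r i) + (∑ j, unitPoint (φ j) * c j) +
        ∑ e, x e * (unitPoint (θ e.1) * unitPoint (φ e.2))) =
      (angleWeight φ * cexp (∑ j, unitPoint (φ j) * c j)) * (angleWeight θ *
        cexp (∑ i, unitPoint (θ i) * (r i + ∑ j, x (i, j) * unitPoint (φ j)))) := by
    intro φ θ
    have : ∑ i, unitPoint (θ i) * (r i + ∑ j, x (i, j) * unitPoint (φ j)) =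
        (∑ i, unitPoint (θ i) * r i) + ∑ e, x e * (unitPoint (θ e.1) * unitPoint (φ e.2)) := by
      rw [Fintype.sum_prod_type, ← Finset.sum_add_distrib]
      refine Finset.sum_congr rfl fun i _ => ?_
      rw [mul_add, Finset.mul_sum]
      congr 1
      exact Finset.sum_congr rfl fun j _ => by ring
    rw [this, add_right_comm, Complex.exp_add _ (∑ j, unitPoint (φ j) * c j)]
    ring
  simp only [h1, integral_const_mul]
  have h2 : ∀ φ : κ → ℝ, (angleWeight φ * cexp (∑ j, unitPoint (φ j) * c j)) *
      ∫ θ, angleWeight θ *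
        cexp (∑ i, unitPoint (θ i) * (r i + ∑ j, x (i, j) * unitPoint (φ j))) ∂anglePi ι =
      ∑ I : Finset (ι × κ), ((∏ e ∈ I, x e) * ∏ i, monomerWeight (rowDeg I i) (r i)) *
        ∏ j, unitWeight (φ j) * (unitPoint (φ j) ^ colDeg I j * cexp (unitPoint (φ j) * c j)) := by
    intro φ
    rw [integral_angleWeight_mul_exp_row r x fun j => unitPoint (φ j), Finset.mul_sum]
    refine Finset.sum_congr rfl fun I _ => ?_
    rw [Complex.exp_sum, angleWeight, Finset.prod_mul_distrib, Finset.prod_mul_distrib]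
    ring
  simp only [h2]
  rw [integral_finsetSum, monomerDimer]
  · refine Finset.sum_congr rfl fun I _ => ?_
    rw [integral_const_mul, integral_fintype_prod_eq_prod (f := fun j φ => unitWeight φ *
          (unitPoint φ ^ colDeg I j * cexp (unitPoint φ * c j)))]
    simp only [integral_unitWeight_mul_pow_mul_exp]
    ring
  · intro I _
    exact (integrable_prod_angle (f := fun j φ => unitWeight φ *
      (unitPoint φ ^ colDeg I j * cexp (unitPoint φ * c j))) fun j =>
      continuous_unitWeight_mul_pow_mul_exp _ _).const_mul _

end MonomerDimer

/-! ### The reweighted matching polynomial through row and column sums -/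

theorem SimpleGraph.sum_sum_adj_eq_two_mul_sum_edgeFinset {V : Type*} [Fintype V] [DecidableEq V]
    (G : SimpleGraph V) [DecidableRel G.Adj] [Fintype G.edgeSet] (f : Sym2 V → ℂ) :
    ∑ u, ∑ v, (if G.Adj u v then f s(u, v) else 0) = 2 * ∑ e ∈ G.edgeFinset, f e := by
  rw [← Fintype.sum_prod_type' (fun u v => if G.Adj u v then f s(u, v) else 0),
    ← Finset.sum_filter, Finset.mul_sum, ← Finset.sum_fiberwise_of_maps_to
      (g := fun p : V × V => s(p.1, p.2)) (t := G.edgeFinset)]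
  · refine Finset.sum_congr rfl fun e he => ?_
    induction e using Sym2.ind with
    | _ u v =>
      have hadj : G.Adj u v := by simpa using he
      have hfib : ((Finset.univ.filter fun p : V × V => G.Adj p.1 p.2).filter
          fun p => s(p.1, p.2) = s(u, v)) = {(u, v), (v, u)} := by
        ext ⟨a, b⟩
        simp only [Finset.mem_filter, Finset.mem_univ, true_and, Finset.mem_insert,
          Finset.mem_singleton, Prod.mk.injEq, Sym2.eq_iff]
        constructor
        · exact fun h => h.2
        · rintro (⟨rfl, rfl⟩ | ⟨rfl, rfl⟩)
          · exact ⟨hadj, Or.inl ⟨rfl, rfl⟩⟩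
          · exact ⟨hadj.symm, Or.inr ⟨rfl, rfl⟩⟩
      rw [hfib, Finset.sum_pair (by simp [hadj.ne]), Sym2.eq_swap (a := v)]
      ring
  · rintro ⟨u, v⟩ h
    simpa using h

/-- Inclusion-exclusion over ordered pairs: same row plus same column counts each diagonal pair
twice. Half of that diagonal excess is already present in `clusterL2`, so only one copy of `∑ x²`
remains. -/
theorem clusterL2_lineGraphKnn (n : ℕ) (x : Fin n × Fin n → ℂ) :
    clusterL2 (lineGraphKnn n) x =
      -(1 / 2) * ((∑ i, (∑ j, x (i, j)) ^ 2) + (∑ j, (∑ i, x (i, j)) ^ 2) - ∑ e, x e ^ 2) := by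
  classical
  have h := (lineGraphKnn n).sum_sum_adj_eq_two_mul_sum_edgeFinset fun p => (p.map x).mul
  simp only [Sym2.map_mk, Sym2.mul_mk] at h
  have hadj : ∀ u v, (if (lineGraphKnn n).Adj u v then x u * x v else 0) =
      (if u.1 = v.1 then x u * x v else 0) + (if u.2 = v.2 then x u * x v else 0) -
        2 * (if u = v then x u * x v else 0) := by
    rintro ⟨a, b⟩ ⟨c, d⟩
    by_cases h1 : a = c <;> by_cases h2 : b = d <;> (simp [lineGraphKnn, h1, h2]; try ring)
  have hr : ∑ u : Fin n × Fin n, ∑ v : Fin n × Fin n, (if u.1 = v.1 then x u * x v else 0) =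
      ∑ i, (∑ j, x (i, j)) ^ 2 := by
    simp only [Fintype.sum_prod_type, sq, Finset.sum_mul_sum]
    refine Finset.sum_congr rfl fun i _ => Finset.sum_congr rfl fun j _ => ?_
    rw [Finset.sum_eq_single i] <;> simp +contextual [eq_comm]
  have hc : ∑ u : Fin n × Fin n, ∑ v : Fin n × Fin n, (if u.2 = v.2 then x u * x v else 0) =
      ∑ j, (∑ i, x (i, j)) ^ 2 := by
    simp only [Fintype.sum_prod_type, sq, Finset.sum_mul_sum]
    rw [Finset.sum_comm]
    simp
  have hd : ∑ u : Fin n × Fin n, ∑ v : Fin n × Fin n, (if u = v then x u * x v else 0) =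
      ∑ e, x e ^ 2 := by
    simp [sq]
  simp only [hadj, Finset.sum_add_distrib, Finset.sum_sub_distrib, ← Finset.mul_sum, hr, hc, hd] at h
  rw [clusterL2]
  linear_combination (1 / 2) * h

theorem monomerWeight_zero_right (d : ℕ) : monomerWeight d 0 = if d ≤ 1 then 1 else 0 := by
  rcases d with _ | _ | d <;> simp [monomerWeight]

theorem isIndepSet_lineGraphKnn_iff {n : ℕ} (I : Finset (Fin n × Fin n)) :
    (lineGraphKnn n).IsIndepSet (I : Set (Fin n × Fin n)) ↔
      (∀ i, rowDeg I i ≤ 1) ∧ ∀ j, colDeg I j ≤ 1 := by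
  simp only [rowDeg, colDeg, Finset.card_le_one, Finset.mem_filter]
  constructor
  · intro h
    refine ⟨fun i a ha b hb => ?_, fun j a ha b hb => ?_⟩
    · by_contra hne
      exact h ha.1 hb.1 hne ⟨hne, Or.inl (ha.2.trans hb.2.symm)⟩
    · by_contra hne
      exact h ha.1 hb.1 hne ⟨hne, Or.inr (ha.2.trans hb.2.symm)⟩
  · rintro ⟨h1, h2⟩ a ha b hb hne ⟨-, h | h⟩
    · exact hne (h1 b.1 a ⟨ha, h⟩ b ⟨hb, rfl⟩)
    · exact hne (h2 b.2 a ⟨ha, h⟩ b ⟨hb, rfl⟩)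

theorem hardcoreZ_eq_sum {V : Type*} [Fintype V] (G : SimpleGraph V) (x : V → ℂ)
    [DecidablePred fun I : Finset V => G.IsIndepSet (I : Set V)] :
    hardcoreZ G x =
      ∑ I : Finset V, if G.IsIndepSet (I : Set V) then ∏ v ∈ I, x v else 0 := by
  classical
  rw [hardcoreZ, Finset.sum_filter]
  -- The index set in `hardcoreZ` is a finset of `Set V`, produced from finsets by a monadic
  -- coercion; injectivity of that coercion turns the sum back into one over `Finset V`.
  simp only [Finset.bind_def, Finset.pure_def]
  rw [Finset.sup_eq_biUnion, Finset.biUnion_singleton]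
  refine (Finset.sum_image Finset.coe_injective.injOn).trans ?_
  refine Finset.sum_congr rfl fun I _ => ?_
  simp only [Finset.toFinset_coe]

theorem hardcoreZ_lineGraphKnn_eq_monomerDimer (n : ℕ) (x : Fin n × Fin n → ℂ) :
    hardcoreZ (lineGraphKnn n) x = monomerDimer 0 0 x := by
  classical
  rw [hardcoreZ_eq_sum, monomerDimer]
  refine Finset.sum_congr rfl fun I _ => ?_
  simp only [Pi.zero_apply, monomerWeight_zero_right, Finset.prod_ite_zero, Finset.mem_univ,
    true_implies, Finset.prod_const_one]
  simp only [isIndepSet_lineGraphKnn_iff]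
  by_cases h1 : ∀ i, rowDeg I i ≤ 1 <;> by_cases h2 : ∀ j, colDeg I j ≤ 1 <;> simp [h1, h2]

/-- The reweighted matching polynomial as a function of independent row sums `R`, column sums `C`
and edge weights `x`. -/
noncomputable def decoupledF {ι κ : Type*} [Fintype ι] [Fintype κ] [DecidableEq ι] [DecidableEq κ]
    (R : ι → ℂ) (C : κ → ℂ) (x : ι × κ → ℂ) : ℂ :=
  cexp ((∑ i, (R i ^ 2 / 2 - R i)) + (∑ j, (C j ^ 2 / 2 - C j)) + ∑ e, x e) *
    monomerDimer (fun i => R i - ∑ j, x (i, j)) (fun j => C j - ∑ i, x (i, j)) x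

/-- With genuine row and column sums the monomer corrections `R i - ∑ x` and `C j - ∑ x` vanish,
leaving the matching polynomial. In the exponent `-∑ R - ∑ C + ∑ x` collapses to `-L₁`. -/
theorem hardcoreF2_lineGraphKnn_eq (n : ℕ) (x : Fin n × Fin n → ℂ) :
    hardcoreF2 (lineGraphKnn n) x =
      decoupledF (fun i => ∑ j, x (i, j)) (fun j => ∑ i, x (i, j)) x *
        cexp (-(∑ e, x e ^ 2) / 2) := by
  have h0 : (fun i => (∑ j, x (i, j)) - ∑ j, x (i, j)) = (0 : Fin n → ℂ) := by ext; simp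
  have h0' : (fun j => (∑ i, x (i, j)) - ∑ i, x (i, j)) = (0 : Fin n → ℂ) := by ext; simp
  rw [hardcoreF2, hardcoreZ_lineGraphKnn_eq_monomerDimer, decoupledF, h0, h0',
    mul_comm (cexp _), mul_assoc, ← Complex.exp_add, clusterL2_lineGraphKnn, clusterL1]
  congr 2
  simp only [Finset.sum_sub_distrib, ← Finset.sum_div]
  have h1 : ∑ i, ∑ j, x (i, j) = ∑ e, x e := (Fintype.sum_prod_type x).symm
  have h2 : ∑ j, ∑ i, x (i, j) = ∑ e, x e := (Fintype.sum_prod_type_right x).symm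
  rw [h1, h2]
  ring

theorem differentiable_monomerWeight (d : ℕ) : Differentiable ℂ (monomerWeight d) := by
  rcases d with _ | _ | d
  · have : monomerWeight 0 = fun r => 1 + r := by ext; simp [monomerWeight]
    rw [this]; fun_prop
  · have : monomerWeight (0 + 1) = fun _ => 1 := by ext; simp [monomerWeight]
    rw [this]; fun_prop
  · have : monomerWeight (d + 1 + 1) = fun _ => 0 := by ext; simp [monomerWeight]
    rw [this]; fun_prop

theorem Differentiable.decoupledF {E ι κ : Type*} [NormedAddCommGroup E] [NormedSpace ℂ E]
    [Fintype ι] [Fintype κ] [DecidableEq ι] [DecidableEq κ] {R : E → ι → ℂ} {C : E → κ → ℂ}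
    {x : E → ι × κ → ℂ} (hR : Differentiable ℂ R) (hC : Differentiable ℂ C)
    (hx : Differentiable ℂ x) : Differentiable ℂ fun v => decoupledF (R v) (C v) (x v) := by
  have hR' := fun i => differentiable_pi.1 hR i
  have hC' := fun i => differentiable_pi.1 hC i
  have hx' := fun i => differentiable_pi.1 hx i
  have hrow : ∀ d i, Differentiable ℂ fun v => monomerWeight d (R v i - ∑ j, x v (i, j)) :=
    fun d i => (differentiable_monomerWeight d).comp (by fun_prop)
  have hcol : ∀ d j, Differentiable ℂ fun v => monomerWeight d (C v j - ∑ i, x v (i, j)) :=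
    fun d j => (differentiable_monomerWeight d).comp (by fun_prop)
  unfold _root_.decoupledF monomerDimer
  fun_prop

/-! ### Replicas: correlation kernels and one-vertex integrals -/

/-- The exponential whose weighted average over unit circles is `decoupledF`. -/
noncomputable def circleKernel {ι κ : Type*} [Fintype ι] [Fintype κ]
    (R : ι → ℂ) (C : κ → ℂ) (x : ι × κ → ℂ) (θ : ι → ℝ) (φ : κ → ℝ) : ℂ :=
  (∏ i, cexp (R i ^ 2 / 2 + (unitPoint (θ i) - 1) * R i)) *
    (∏ j, cexp (C j ^ 2 / 2 + (unitPoint (φ j) - 1) * C j)) *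
    ∏ e : ι × κ, cexp ((unitPoint (θ e.1) - 1) * (unitPoint (φ e.2) - 1) * x e)

/-- The terms `x`, `-a x`, `-b x` and `a b x` combine into `(a - 1)(b - 1) x`; this is the reason
for the monomer corrections and the factor `exp (∑ x)` in `decoupledF`. -/
theorem integral_integral_circleKernel {ι κ : Type*} [Fintype ι] [Fintype κ] [DecidableEq ι]
    [DecidableEq κ] (R : ι → ℂ) (C : κ → ℂ) (x : ι × κ → ℂ) :
    ∫ φ, ∫ θ, angleWeight θ * angleWeight φ * circleKernel R C x θ φ ∂anglePi ι ∂anglePi κ =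
      decoupledF R C x := by
  rw [decoupledF, ← integral_integral_exp_eq_monomerDimer, ← integral_const_mul]
  refine integral_congr_ae (Filter.Eventually.of_forall fun φ => ?_)
  simp only
  rw [← integral_const_mul]
  refine integral_congr_ae (Filter.Eventually.of_forall fun θ => ?_)
  simp only
  rw [mul_left_comm]
  congr 1
  rw [circleKernel, ← Complex.exp_sum, ← Complex.exp_sum, ← Complex.exp_sum, ← Complex.exp_add,
    ← Complex.exp_add, ← Complex.exp_add]
  congr 1
  simp only [mul_sub, sub_mul, Finset.sum_add_distrib, Finset.sum_sub_distrib, Finset.mul_sum,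
    one_mul, mul_one]
  have h1 : ∑ i, ∑ j, unitPoint (θ i) * x (i, j) = ∑ e : ι × κ, unitPoint (θ e.1) * x e :=
    (Fintype.sum_prod_type fun e : ι × κ => unitPoint (θ e.1) * x e).symm
  have h2 : ∑ j, ∑ i, unitPoint (φ j) * x (i, j) = ∑ e : ι × κ, unitPoint (φ e.2) * x e :=
    (Fintype.sum_prod_type_right fun e : ι × κ => unitPoint (φ e.2) * x e).symm
  have h3 : ∑ e : ι × κ, x e * (unitPoint (θ e.1) * unitPoint (φ e.2)) =
      ∑ e : ι × κ, unitPoint (θ e.1) * unitPoint (φ e.2) * x e :=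
    Finset.sum_congr rfl fun e _ => by ring
  rw [h1, h2, h3]
  ring

/-- The second moment of an average of functions is the average of their inner products. -/
theorem lintegral_enorm_integral_sq_le {Θ Q : Type*} [MeasurableSpace Θ] [MeasurableSpace Q]
    {τ : Measure Θ} {P : Measure Q} [IsProbabilityMeasure τ] [IsProbabilityMeasure P]
    {g : Θ → Q → ℂ} (hg : Measurable fun p : Θ × Q => g p.1 p.2) {B : Q → ℝ}
    (hB : ∀ θ q, ‖g θ q‖ ≤ B q) (hi : Integrable (fun q => B q ^ 2) P) :
    ∫⁻ q, ‖∫ θ, g θ q ∂τ‖ₑ ^ 2 ∂P ≤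
      ‖∫ z : Θ × Θ, ∫ q, g z.1 q * conj (g z.2 q) ∂P ∂(τ.prod τ)‖ₑ := by
  have hF : StronglyMeasurable fun q => ∫ θ, g θ q ∂τ :=
    (hg.comp measurable_swap).stronglyMeasurable.integral_prod_right'
  have hFB : ∀ q, ‖∫ θ, g θ q ∂τ‖ ≤ B q := fun q => by
    refine (norm_integral_le_of_norm_le_const (Filter.Eventually.of_forall fun θ => hB θ q)).trans ?_
    simp
  have hint : Integrable (fun q => ‖∫ θ, g θ q ∂τ‖ ^ 2) P := by
    refine hi.mono' (hF.norm.pow 2).aestronglyMeasurable (Filter.Eventually.of_forall fun q => ?_)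
    rw [Real.norm_of_nonneg (by positivity)]
    exact pow_le_pow_left₀ (norm_nonneg _) (hFB q) 2
  have h1 : ∫⁻ q, ‖∫ θ, g θ q ∂τ‖ₑ ^ 2 ∂P = ENNReal.ofReal (∫ q, ‖∫ θ, g θ q ∂τ‖ ^ 2 ∂P) := by
    rw [ofReal_integral_eq_lintegral_ofReal hint
      (Filter.Eventually.of_forall fun q => by positivity)]
    refine lintegral_congr fun q => ?_
    rw [← ofReal_norm, ENNReal.ofReal_pow (norm_nonneg _)]
  have hm : Measurable fun p : Q × (Θ × Θ) => g p.2.1 p.1 * conj (g p.2.2 p.1) := by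
    refine (hg.comp (f := fun p : Q × (Θ × Θ) => (p.2.1, p.1)) (by fun_prop)).mul ?_
    exact Complex.continuous_conj.measurable.comp
      (hg.comp (f := fun p : Q × (Θ × Θ) => (p.2.2, p.1)) (by fun_prop))
  -- The squared modulus of an average is a double average over two independent copies of the
  -- parameter.
  have h2 : ((∫ q, ‖∫ θ, g θ q ∂τ‖ ^ 2 ∂P : ℝ) : ℂ) =
      ∫ q, ∫ z : Θ × Θ, g z.1 q * conj (g z.2 q) ∂(τ.prod τ) ∂P := by
    rw [← integral_complex_ofReal]
    refine integral_congr_ae (Filter.Eventually.of_forall fun q => ?_)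
    simp only
    rw [integral_prod_mul (fun θ => g θ q) (fun θ => conj (g θ q)), integral_conj,
      Complex.mul_conj']
    push_cast
    rfl
  rw [h1, integral_integral_swap, ← h2]
  · rw [← ofReal_norm, Complex.norm_real]
    exact ENNReal.ofReal_le_ofReal (le_abs_self _)
  · have hswap : Integrable (fun p : Q × (Θ × Θ) => g p.2.1 p.1 * conj (g p.2.2 p.1))
        (P.prod (τ.prod τ)) := by
      refine (hi.comp_fst (τ.prod τ)).mono' hm.aestronglyMeasurable
        (Filter.Eventually.of_forall fun p => ?_)
      rw [norm_mul, RCLike.norm_conj, sq]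
      exact mul_le_mul (hB _ _) (hB _ _) (norm_nonneg _) ((norm_nonneg _).trans (hB p.2.1 p.1))
    exact hswap.swap

/-- Both circle averages are instances of `f ↦ f 0 + deriv f 0`, so the value is an explicit
derivative: first in the conjugated variable, then in the other. -/
theorem integral_integral_unitWeight_exp (σ τ : ℂ) :
    ∫ θ, ∫ θ', unitWeight θ * conj (unitWeight θ') *
      cexp (σ / 2 * ((unitPoint θ - 1) ^ 2 + (conj (unitPoint θ') - 1) ^ 2) +
        τ * (unitPoint θ - 1) * (conj (unitPoint θ') - 1)) ∂angleMeasure ∂angleMeasure =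
      cexp (σ + τ) * (1 - (σ + τ) + (σ + τ) ^ 2 - σ) := by
  have hinner : ∀ a : ℂ, ∫ θ', conj (unitWeight θ') *
      cexp (σ / 2 * ((a - 1) ^ 2 + (conj (unitPoint θ') - 1) ^ 2) +
        τ * (a - 1) * (conj (unitPoint θ') - 1)) ∂angleMeasure =
      cexp (σ / 2 * ((a - 1) ^ 2 + 1) - τ * (a - 1)) * (1 - σ + τ * (a - 1)) := by
    intro a
    rw [integral_conj_unitWeight_mul
      (f := fun c => cexp (σ / 2 * ((a - 1) ^ 2 + (c - 1) ^ 2) + τ * (a - 1) * (c - 1)))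
      (by fun_prop)]
    have h : HasDerivAt (fun c : ℂ =>
        cexp (σ / 2 * ((a - 1) ^ 2 + (c - 1) ^ 2) + τ * (a - 1) * (c - 1)))
        (cexp (σ / 2 * ((a - 1) ^ 2 + (0 - 1) ^ 2) + τ * (a - 1) * (0 - 1)) *
          (σ / 2 * (2 * (0 - 1)) + τ * (a - 1) * 1)) 0 := by
      have hc : HasDerivAt (fun c : ℂ => c - 1) 1 0 := (hasDerivAt_id (0 : ℂ)).sub_const 1
      have hc2 : HasDerivAt (fun c : ℂ => (c - 1) ^ 2) (2 * (0 - 1)) 0 := by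
        simpa using hc.fun_pow 2
      exact (((hc2.const_add _).const_mul _).add (hc.const_mul _)).cexp
    rw [h.deriv]
    ring_nf
  have hmul : ∀ θ θ', unitWeight θ * conj (unitWeight θ') *
      cexp (σ / 2 * ((unitPoint θ - 1) ^ 2 + (conj (unitPoint θ') - 1) ^ 2) +
        τ * (unitPoint θ - 1) * (conj (unitPoint θ') - 1)) = unitWeight θ *
      (conj (unitWeight θ') *
        cexp (σ / 2 * ((unitPoint θ - 1) ^ 2 + (conj (unitPoint θ') - 1) ^ 2) +
          τ * (unitPoint θ - 1) * (conj (unitPoint θ') - 1))) := fun _ _ => mul_assoc _ _ _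
  simp only [hmul, integral_const_mul, hinner]
  rw [integral_unitWeight_mul (f := fun a => cexp (σ / 2 * ((a - 1) ^ 2 + 1) - τ * (a - 1)) *
    (1 - σ + τ * (a - 1))) (by fun_prop)]
  have h : HasDerivAt (fun a : ℂ => cexp (σ / 2 * ((a - 1) ^ 2 + 1) - τ * (a - 1)) *
      (1 - σ + τ * (a - 1)))
      (cexp (σ / 2 * ((0 - 1) ^ 2 + 1) - τ * (0 - 1)) * (σ / 2 * (2 * (0 - 1)) - τ * 1) *
        (1 - σ + τ * (0 - 1)) + cexp (σ / 2 * ((0 - 1) ^ 2 + 1) - τ * (0 - 1)) * (τ * 1)) 0 := by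
    have hc : HasDerivAt (fun c : ℂ => c - 1) 1 0 := (hasDerivAt_id (0 : ℂ)).sub_const 1
    have hc2 : HasDerivAt (fun c : ℂ => (c - 1) ^ 2) (2 * (0 - 1)) 0 := by
      simpa using hc.fun_pow 2
    exact (((hc2.add_const _).const_mul _).sub (hc.const_mul _)).cexp.mul
      ((hc.const_mul τ).const_add _)
  rw [h.deriv]
  ring_nf

theorem integral_integral_prod_eq_pow {ι : Type*} [Fintype ι] (h : ℝ → ℝ → ℂ) :
    ∫ θ, ∫ θ', ∏ i, h (θ i) (θ' i) ∂anglePi ι ∂anglePi ι =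
      (∫ θ, ∫ θ', h θ θ' ∂angleMeasure ∂angleMeasure) ^ Fintype.card ι := by
  have h1 : ∀ θ : ι → ℝ, ∫ θ', ∏ i, h (θ i) (θ' i) ∂anglePi ι =
      ∏ i, ∫ θ', h (θ i) θ' ∂angleMeasure := fun θ =>
    integral_fintype_prod_eq_prod (f := fun i θ' => h (θ i) θ')
  simp only [h1]
  rw [integral_fintype_prod_eq_prod (f := fun (_ : ι) θ => ∫ θ', h θ θ' ∂angleMeasure)]
  simp

/-- The contribution of one vertex to the second moment of `decoupledF`. -/
noncomputable def siteFactor (s : ℝ) (u : ℂ) : ℂ :=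
  ((√(1 - s ^ 2))⁻¹ : ℝ) * (cexp (s / (1 - s) + u) *
    (1 - (s / (1 - s) + u) + (s / (1 - s) + u) ^ 2 - s ^ 2 / (1 - s ^ 2)))

/-- The correlation kernel of one vertex. -/
noncomputable def siteKernel (s : ℝ) (θ θ' : ℝ) : ℂ :=
  ((√(1 - s ^ 2))⁻¹ : ℝ) * cexp ((s * ((unitPoint θ - 1) * (conj (unitPoint θ') - 1)) +
    s ^ 2 / 2 * ((unitPoint θ - 1) ^ 2 + (conj (unitPoint θ') - 1) ^ 2)) / (1 - s ^ 2))

theorem integral_siteKernel {s : ℝ} (hs0 : 0 ≤ s) (hs : s < 1) (u : ℂ) :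
    ∫ θ, ∫ θ', unitWeight θ * conj (unitWeight θ') * (siteKernel s θ θ' *
      cexp (u * ((unitPoint θ - 1) * (conj (unitPoint θ') - 1)))) ∂angleMeasure ∂angleMeasure =
      siteFactor s u := by
  have h1 : (1 - s : ℂ) ≠ 0 := by
    have : (1 - s : ℝ) ≠ 0 := by linarith
    exact_mod_cast this
  have h2 : (1 + s : ℂ) ≠ 0 := by
    have : (1 + s : ℝ) ≠ 0 := by positivity
    exact_mod_cast this
  have h3 : (1 - s ^ 2 : ℂ) = (1 - s) * (1 + s) := by ring
  have key : ∀ θ θ', unitWeight θ * conj (unitWeight θ') * (siteKernel s θ θ' *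
      cexp (u * ((unitPoint θ - 1) * (conj (unitPoint θ') - 1)))) =
      ((√(1 - s ^ 2))⁻¹ : ℝ) * (unitWeight θ * conj (unitWeight θ') *
      cexp ((s ^ 2 / (1 - s ^ 2)) / 2 * ((unitPoint θ - 1) ^ 2 + (conj (unitPoint θ') - 1) ^ 2) +
        (s / (1 - s ^ 2) + u) * (unitPoint θ - 1) * (conj (unitPoint θ') - 1))) := by
    intro θ θ'
    rw [siteKernel, mul_assoc _ (cexp _), ← Complex.exp_add, mul_left_comm]
    congr 3
    ring
  simp only [key, integral_const_mul, integral_integral_unitWeight_exp]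
  rw [siteFactor]
  have h4 : (s ^ 2 / (1 - s ^ 2) + (s / (1 - s ^ 2) + u) : ℂ) = s / (1 - s) + u := by
    rw [h3]; field_simp; ring
  rw [h4]

/-- The square of a row or column sum and its conjugate form the quadratic exponent with `q = s`;
this is where `s < 1` is needed. -/
theorem integral_exp_site {s : ℝ} (hs0 : 0 ≤ s) (hs : s < 1) (θ θ' : ℝ) :
    ∫ w, cexp (((√s : ℂ) * w) ^ 2 / 2 + (unitPoint θ - 1) * ((√s : ℂ) * w)) *
      conj (cexp (((√s : ℂ) * w) ^ 2 / 2 + (unitPoint θ' - 1) * ((√s : ℂ) * w)))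
        ∂stdComplexGaussian = siteKernel s θ θ' := by
  have hsq : (√s : ℂ) ^ 2 = s := by rw [← Complex.ofReal_pow, Real.sq_sqrt hs0]
  have h := integral_cexp_quadratic_stdComplexGaussian (q := s) (by rwa [abs_of_nonneg hs0])
    ((unitPoint θ - 1) * √s) ((conj (unitPoint θ') - 1) * √s)
  rw [siteKernel]
  refine Eq.trans ?_ (h.trans ?_)
  · refine integral_congr_ae (Filter.Eventually.of_forall fun w => ?_)
    simp only
    rw [← Complex.exp_conj, ← Complex.exp_add]
    congr 1
    simp only [map_add, map_mul, map_sub, map_div₀, map_pow, conj_ofReal, map_one, map_ofNat]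
    linear_combination (w ^ 2 / 2 + conj w ^ 2 / 2) * hsq
  · congr 3
    linear_combination ((unitPoint θ - 1) * (conj (unitPoint θ') - 1) +
      s / 2 * ((unitPoint θ - 1) ^ 2 + (conj (unitPoint θ') - 1) ^ 2)) * hsq

theorem integral_exp_edge {t : ℝ} (ht : 0 ≤ t) (a b : ℂ) :
    ∫ w, cexp (a * ((√t : ℂ) * w)) * conj (cexp (b * ((√t : ℂ) * w))) ∂stdComplexGaussian =
      cexp (t * (a * conj b)) := by
  have hsq : (√t : ℂ) ^ 2 = t := by rw [← Complex.ofReal_pow, Real.sq_sqrt ht]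
  have h := integral_cexp_linear_stdComplexGaussian (a * √t) (conj b * √t)
  refine Eq.trans ?_ (h.trans ?_)
  · refine integral_congr_ae (Filter.Eventually.of_forall fun w => ?_)
    simp only
    rw [← Complex.exp_conj, ← Complex.exp_add]
    congr 1
    simp only [map_mul, conj_ofReal]
    ring
  · congr 1
    linear_combination (a * conj b) * hsq

/-! ### The two-replica formula for the second moment -/

section Replica

variable {ι κ : Type*} [Fintype ι] [Fintype κ]

/-- The integrand of the circle representation of `decoupledF` at Gaussian arguments. -/
noncomputable def replicaIntegrand (s t : ℝ) (p : (κ → ℝ) × (ι → ℝ))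
    (q : ((ι → ℂ) × (κ → ℂ)) × (ι × κ → ℂ)) : ℂ :=
  angleWeight p.2 * angleWeight p.1 * circleKernel ((√s : ℂ) • q.1.1) ((√s : ℂ) • q.1.2)
    ((√t : ℂ) • q.2) p.2 p.1

/-- A bound for `replicaIntegrand` that is uniform in the angles. -/
noncomputable def replicaBound (s t : ℝ) (q : ((ι → ℂ) × (κ → ℂ)) × (ι × κ → ℂ)) : ℝ :=
  2 ^ Fintype.card ι * 2 ^ Fintype.card κ *
    ((∏ i, Real.exp (s / 2 * ‖q.1.1 i‖ ^ 2 + 2 * √s * ‖q.1.1 i‖)) *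
      (∏ j, Real.exp (s / 2 * ‖q.1.2 j‖ ^ 2 + 2 * √s * ‖q.1.2 j‖)) *
      ∏ e, Real.exp (4 * √t * ‖q.2 e‖))

theorem norm_angleWeight_le (θ : ι → ℝ) : ‖angleWeight θ‖ ≤ 2 ^ Fintype.card ι := by
  rw [angleWeight, norm_prod]
  refine (Finset.prod_le_prod (fun _ _ => norm_nonneg _) fun i _ => norm_unitWeight_le (θ i)).trans ?_
  simp

theorem norm_unitPoint_sub_one_le (θ : ℝ) : ‖unitPoint θ - 1‖ ≤ 2 := by
  refine (norm_sub_le _ _).trans ?_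
  rw [norm_unitPoint, norm_one]; norm_num

theorem norm_cexp_site_le {s : ℝ} (hs : 0 ≤ s) (θ : ℝ) (w : ℂ) :
    ‖cexp (((√s : ℂ) * w) ^ 2 / 2 + (unitPoint θ - 1) * ((√s : ℂ) * w))‖ ≤
      Real.exp (s / 2 * ‖w‖ ^ 2 + 2 * √s * ‖w‖) := by
  refine (Complex.norm_exp_le_exp_norm _).trans (Real.exp_le_exp.2 ((norm_add_le _ _).trans ?_))
  have h1 : ‖(√s : ℂ)‖ = √s := by simp [abs_of_nonneg (Real.sqrt_nonneg s)]
  rw [norm_div, norm_pow, norm_mul, norm_mul, norm_mul, h1, mul_pow, Real.sq_sqrt hs,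
    Complex.norm_ofNat]
  have h2 := mul_le_mul_of_nonneg_right (norm_unitPoint_sub_one_le θ)
    (mul_nonneg (Real.sqrt_nonneg s) (norm_nonneg w))
  linarith

theorem norm_cexp_edge_le (t : ℝ) (θ φ : ℝ) (w : ℂ) :
    ‖cexp ((unitPoint θ - 1) * (unitPoint φ - 1) * ((√t : ℂ) * w))‖ ≤
      Real.exp (4 * √t * ‖w‖) := by
  refine (Complex.norm_exp_le_exp_norm _).trans (Real.exp_le_exp.2 ?_)
  have h1 : ‖(√t : ℂ)‖ = √t := by simp [abs_of_nonneg (Real.sqrt_nonneg t)]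
  rw [norm_mul, norm_mul, norm_mul, h1, mul_assoc 4]
  have h2 := mul_le_mul (norm_unitPoint_sub_one_le θ) (norm_unitPoint_sub_one_le φ)
    (norm_nonneg _) (by norm_num)
  refine mul_le_mul_of_nonneg_right (h2.trans (by norm_num)) (by positivity)

theorem norm_replicaIntegrand_le {s : ℝ} (hs : 0 ≤ s) (t : ℝ) (p : (κ → ℝ) × (ι → ℝ))
    (q : ((ι → ℂ) × (κ → ℂ)) × (ι × κ → ℂ)) :
    ‖replicaIntegrand s t p q‖ ≤ replicaBound s t q := by
  rw [replicaIntegrand, replicaBound, norm_mul, norm_mul, circleKernel, norm_mul, norm_mul,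
    norm_prod, norm_prod, norm_prod]
  simp only [Pi.smul_apply, smul_eq_mul]
  gcongr with i _ j _ e _
  · exact norm_angleWeight_le _
  · exact norm_angleWeight_le _
  · exact norm_cexp_site_le hs _ _
  · exact norm_cexp_site_le hs _ _
  · exact norm_cexp_edge_le _ _ _ _

theorem integrable_replicaBound_sq {s : ℝ} (hs1 : s < 1) (t : ℝ) :
    Integrable (fun q : ((ι → ℂ) × (κ → ℂ)) × (ι × κ → ℂ) => replicaBound s t q ^ 2)
      (((stdComplexGaussianPi ι).prod (stdComplexGaussianPi κ)).prod
        (stdComplexGaussianPi (ι × κ))) := by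
  -- Squaring doubles the quadratic coefficient from `s / 2` to `s`, still below the Gaussian
  -- threshold 1.
  have hsite : Integrable (fun w : ℂ => Real.exp (s / 2 * ‖w‖ ^ 2 + 2 * √s * ‖w‖) ^ 2)
      stdComplexGaussian := by
    refine (integrable_exp_quadratic_norm hs1 (4 * √s)).congr
      (Filter.Eventually.of_forall fun w => ?_)
    simp only
    rw [← Real.exp_nat_mul]; congr 1; push_cast; ring
  have hedge : Integrable (fun w : ℂ => Real.exp (4 * √t * ‖w‖) ^ 2) stdComplexGaussian := by
    refine (integrable_exp_quadratic_norm zero_lt_one (8 * √t)).congr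
      (Filter.Eventually.of_forall fun w => ?_)
    simp only
    rw [← Real.exp_nat_mul]; congr 1; push_cast; ring
  have h1 := Integrable.fintype_prod (ι := ι) (μ := fun _ => stdComplexGaussian) fun _ => hsite
  have h2 := Integrable.fintype_prod (ι := κ) (μ := fun _ => stdComplexGaussian) fun _ => hsite
  have h3 := Integrable.fintype_prod (ι := ι × κ) (μ := fun _ => stdComplexGaussian) fun _ => hedge
  refine (((h1.mul_prod h2).mul_prod h3).const_mul
    ((2 ^ Fintype.card ι * 2 ^ Fintype.card κ) ^ 2)).congr
    (Filter.Eventually.of_forall fun q => ?_)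
  simp only [replicaBound, mul_pow, Finset.prod_pow]

theorem continuous_replicaIntegrand (s t : ℝ) :
    Continuous fun p : ((κ → ℝ) × (ι → ℝ)) × (((ι → ℂ) × (κ → ℂ)) × (ι × κ → ℂ)) =>
      replicaIntegrand s t p.1 p.2 := by
  have h1 := continuous_unitPoint
  have h2 := continuous_unitWeight
  have h3 := continuous_angleWeight (ι := ι)
  have h4 := continuous_angleWeight (ι := κ)
  unfold replicaIntegrand circleKernel
  simp only [Pi.smul_apply, smul_eq_mul]
  fun_prop

theorem integral_replicaIntegrand [DecidableEq ι] [DecidableEq κ] {s : ℝ} (hs : 0 ≤ s) (t : ℝ)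
    (q : ((ι → ℂ) × (κ → ℂ)) × (ι × κ → ℂ)) :
    ∫ p, replicaIntegrand s t p q ∂((anglePi κ).prod (anglePi ι)) =
      decoupledF ((√s : ℂ) • q.1.1) ((√s : ℂ) • q.1.2) ((√t : ℂ) • q.2) := by
  rw [integral_prod, ← integral_integral_circleKernel]
  · rfl
  · refine Integrable.of_bound (C := replicaBound s t q) ?_
      (Filter.Eventually.of_forall fun p => norm_replicaIntegrand_le hs t p q)
    exact ((continuous_replicaIntegrand s t).comp
      (Continuous.prodMk_left q)).aestronglyMeasurable

/-- By independence the Gaussian average is a product over vertices and edges. The edge exponents `t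
(a - 1)(conj a' - 1)(b - 1)(conj b' - 1)` sum to a product of a row sum and a column sum: the
interaction has rank one. -/
theorem integral_replicaIntegrand_mul_conj {s t : ℝ} (hs : 0 ≤ s) (hs1 : s < 1) (ht : 0 ≤ t)
    (p p' : (κ → ℝ) × (ι → ℝ)) :
    ∫ q, replicaIntegrand s t p q * conj (replicaIntegrand s t p' q)
      ∂(((stdComplexGaussianPi ι).prod (stdComplexGaussianPi κ)).prod
        (stdComplexGaussianPi (ι × κ))) =
    (angleWeight p.2 * angleWeight p.1 * conj (angleWeight p'.2 * angleWeight p'.1)) *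
      ((∏ i, siteKernel s (p.2 i) (p'.2 i)) * (∏ j, siteKernel s (p.1 j) (p'.1 j)) *
      cexp (t * ((∑ i, (unitPoint (p.2 i) - 1) * (conj (unitPoint (p'.2 i)) - 1)) *
        ∑ j, (unitPoint (p.1 j) - 1) * (conj (unitPoint (p'.1 j)) - 1)))) := by
  let S : ℝ → ℝ → ℂ → ℂ := fun θ θ' w =>
    cexp (((√s : ℂ) * w) ^ 2 / 2 + (unitPoint θ - 1) * ((√s : ℂ) * w)) *
      conj (cexp (((√s : ℂ) * w) ^ 2 / 2 + (unitPoint θ' - 1) * ((√s : ℂ) * w)))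
  let T : ι × κ → ℂ → ℂ := fun e w =>
    cexp ((unitPoint (p.2 e.1) - 1) * (unitPoint (p.1 e.2) - 1) * ((√t : ℂ) * w)) *
      conj (cexp ((unitPoint (p'.2 e.1) - 1) * (unitPoint (p'.1 e.2) - 1) * ((√t : ℂ) * w)))
  have key : ∀ q : ((ι → ℂ) × (κ → ℂ)) × (ι × κ → ℂ),
      replicaIntegrand s t p q * conj (replicaIntegrand s t p' q) =
      (angleWeight p.2 * angleWeight p.1 * conj (angleWeight p'.2 * angleWeight p'.1)) *
        (((∏ i, S (p.2 i) (p'.2 i) (q.1.1 i)) * ∏ j, S (p.1 j) (p'.1 j) (q.1.2 j)) *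
          ∏ e, T e (q.2 e)) := by
    intro q
    simp only [replicaIntegrand, circleKernel, S, T, map_mul, map_prod, Finset.prod_mul_distrib,
      Pi.smul_apply, smul_eq_mul]
    ring
  simp only [key]
  rw [integral_const_mul, integral_prod_mul
    (fun q : (ι → ℂ) × (κ → ℂ) =>
      (∏ i, S (p.2 i) (p'.2 i) (q.1 i)) * ∏ j, S (p.1 j) (p'.1 j) (q.2 j))
    (fun q : ι × κ → ℂ => ∏ e, T e (q e)),
    integral_prod_mul (fun q : ι → ℂ => ∏ i, S (p.2 i) (p'.2 i) (q i))
      (fun q : κ → ℂ => ∏ j, S (p.1 j) (p'.1 j) (q j)),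
    integral_fintype_prod_eq_prod (f := fun i w => S (p.2 i) (p'.2 i) w),
    integral_fintype_prod_eq_prod (f := fun j w => S (p.1 j) (p'.1 j) w),
    integral_fintype_prod_eq_prod (f := T)]
  simp only [S, T, integral_exp_site hs hs1, integral_exp_edge ht]
  congr 2
  rw [← Complex.exp_sum]
  congr 1
  rw [Finset.sum_mul_sum, ← Fintype.sum_prod_type' (fun i j =>
    (unitPoint (p.2 i) - 1) * (conj (unitPoint (p'.2 i)) - 1) *
      ((unitPoint (p.1 j) - 1) * (conj (unitPoint (p'.1 j)) - 1))), Finset.mul_sum]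
  refine Finset.sum_congr rfl fun e _ => ?_
  simp only [map_mul, map_sub, map_one]
  ring

end Replica

theorem norm_siteKernel_le {s : ℝ} (hs : 0 ≤ s) (hs1 : s < 1) (θ θ' : ℝ) :
    ‖siteKernel s θ θ'‖ ≤ (√(1 - s ^ 2))⁻¹ * Real.exp ((4 * s + 4 * s ^ 2) / (1 - s ^ 2)) := by
  have h0 : 0 < 1 - s ^ 2 := by nlinarith
  have h1 := norm_unitPoint_sub_one_le θ
  have h2 : ‖conj (unitPoint θ') - 1‖ ≤ 2 := by
    have := norm_unitPoint_sub_one_le θ'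
    rwa [← RCLike.norm_conj, map_sub, map_one] at this
  rw [siteKernel, norm_mul, Complex.norm_real, Real.norm_of_nonneg (by positivity)]
  refine mul_le_mul_of_nonneg_left ?_ (by positivity)
  refine (Complex.norm_exp_le_exp_norm _).trans (Real.exp_le_exp.2 ?_)
  have h3 : ‖(1 - s ^ 2 : ℂ)‖ = 1 - s ^ 2 := by
    rw [← Complex.ofReal_pow, ← Complex.ofReal_one, ← Complex.ofReal_sub, Complex.norm_real,
      Real.norm_of_nonneg h0.le]
  rw [norm_div, h3]
  gcongr
  refine (norm_add_le _ _).trans (add_le_add ?_ ?_)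
  · rw [norm_mul, norm_mul, Complex.norm_real, Real.norm_of_nonneg hs]
    nlinarith [mul_le_mul h1 h2 (norm_nonneg _) zero_le_two]
  · rw [norm_mul, norm_div, norm_pow, Complex.norm_real, Real.norm_of_nonneg hs, Complex.norm_ofNat]
    have h4 : ‖(unitPoint θ - 1) ^ 2 + (conj (unitPoint θ') - 1) ^ 2‖ ≤ 8 := by
      refine (norm_add_le _ _).trans ?_
      rw [norm_pow, norm_pow]
      nlinarith [norm_nonneg (unitPoint θ - 1), norm_nonneg (conj (unitPoint θ') - 1)]
    nlinarith [mul_le_mul_of_nonneg_left h4 (by positivity : 0 ≤ s ^ 2 / 2)]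

/-! ### Linearising the interaction -/

/-- A vertex factor after the interaction has been linearised by a Gaussian variable. -/
noncomputable def linearisedSite (s : ℝ) (u : ℂ) (θ θ' : ℝ) : ℂ :=
  unitWeight θ * conj (unitWeight θ') * (siteKernel s θ θ' *
    cexp (u * ((unitPoint θ - 1) * (conj (unitPoint θ') - 1))))

theorem norm_linearisedSite_le {s : ℝ} (hs : 0 ≤ s) (hs1 : s < 1) (u : ℂ) (θ θ' : ℝ) :
    ‖linearisedSite s u θ θ'‖ ≤
      4 * ((√(1 - s ^ 2))⁻¹ * Real.exp ((4 * s + 4 * s ^ 2) / (1 - s ^ 2))) *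
        Real.exp (4 * ‖u‖) := by
  have h1 := norm_unitPoint_sub_one_le θ
  have h2 : ‖conj (unitPoint θ') - 1‖ ≤ 2 := by
    have := norm_unitPoint_sub_one_le θ'
    rwa [← RCLike.norm_conj, map_sub, map_one] at this
  rw [linearisedSite, norm_mul, norm_mul, norm_mul, RCLike.norm_conj, ← mul_assoc]
  gcongr
  · nlinarith [norm_unitWeight_le θ, norm_unitWeight_le θ', norm_nonneg (unitWeight θ),
      norm_nonneg (unitWeight θ')]
  · exact norm_siteKernel_le hs hs1 θ θ'
  · refine (Complex.norm_exp_le_exp_norm _).trans (Real.exp_le_exp.2 ?_)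
    rw [norm_mul, norm_mul]
    nlinarith [mul_le_mul h1 h2 (norm_nonneg _) zero_le_two, norm_nonneg u]

theorem continuous_linearisedSite (s : ℝ) :
    Continuous fun p : ℂ × ℝ × ℝ => linearisedSite s p.1 p.2.1 p.2.2 := by
  have h1 := continuous_unitPoint
  have h2 := continuous_unitWeight
  unfold linearisedSite siteKernel
  simp only [div_eq_mul_inv]
  fun_prop

section Replica

variable {ι κ : Type*} [Fintype ι] [Fintype κ]

/-- Hubbard-Stratonovich transform: `exp (t U V)` is the mean of `exp (√t U ζ + √t V conj ζ)` over a
complex Gaussian `ζ`. Given `ζ`, distinct vertices no longer interact. -/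
theorem integral_linearisedSite {s t : ℝ} (ht : 0 ≤ t)
    (p p' : (κ → ℝ) × (ι → ℝ)) :
    ∫ ζ, (∏ i, linearisedSite s (√t * ζ) (p.2 i) (p'.2 i)) *
      ∏ j, linearisedSite s (√t * conj ζ) (p.1 j) (p'.1 j) ∂stdComplexGaussian =
    (angleWeight p.2 * angleWeight p.1 * conj (angleWeight p'.2 * angleWeight p'.1)) *
      ((∏ i, siteKernel s (p.2 i) (p'.2 i)) * (∏ j, siteKernel s (p.1 j) (p'.1 j)) *
      cexp (t * ((∑ i, (unitPoint (p.2 i) - 1) * (conj (unitPoint (p'.2 i)) - 1)) *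
        ∑ j, (unitPoint (p.1 j) - 1) * (conj (unitPoint (p'.1 j)) - 1)))) := by
  have hsq : (√t : ℂ) ^ 2 = t := by rw [← Complex.ofReal_pow, Real.sq_sqrt ht]
  set U := ∑ i, (unitPoint (p.2 i) - 1) * (conj (unitPoint (p'.2 i)) - 1) with hU
  set V := ∑ j, (unitPoint (p.1 j) - 1) * (conj (unitPoint (p'.1 j)) - 1) with hV
  have key : ∀ ζ : ℂ, (∏ i, linearisedSite s (√t * ζ) (p.2 i) (p'.2 i)) *
      ∏ j, linearisedSite s (√t * conj ζ) (p.1 j) (p'.1 j) =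
      (angleWeight p.2 * angleWeight p.1 * conj (angleWeight p'.2 * angleWeight p'.1)) *
      ((∏ i, siteKernel s (p.2 i) (p'.2 i)) * ∏ j, siteKernel s (p.1 j) (p'.1 j)) *
        cexp ((√t * U) * ζ + (√t * V) * conj ζ) := by
    intro ζ
    have h1 : cexp ((√t * U) * ζ + (√t * V) * conj ζ) =
        (∏ i, cexp (√t * ζ * ((unitPoint (p.2 i) - 1) * (conj (unitPoint (p'.2 i)) - 1)))) *
        ∏ j, cexp (√t * conj ζ *
          ((unitPoint (p.1 j) - 1) * (conj (unitPoint (p'.1 j)) - 1))) := by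
      rw [← Complex.exp_sum, ← Complex.exp_sum, ← Complex.exp_add, ← Finset.mul_sum,
        ← Finset.mul_sum, ← hU, ← hV]
      congr 1
      ring
    rw [h1]
    simp only [linearisedSite, angleWeight, Finset.prod_mul_distrib, map_mul, map_prod]
    ring
  simp only [key]
  rw [integral_const_mul, integral_cexp_linear_stdComplexGaussian, mul_assoc]
  congr 3
  linear_combination (U * V) * hsq

theorem integrable_linearisedSite {s : ℝ} (hs : 0 ≤ s) (hs1 : s < 1) (t : ℝ) :
    Integrable (fun w : (((κ → ℝ) × (ι → ℝ)) × ((κ → ℝ) × (ι → ℝ))) × ℂ =>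
      (∏ i, linearisedSite s (√t * w.2) (w.1.1.2 i) (w.1.2.2 i)) *
        ∏ j, linearisedSite s (√t * conj w.2) (w.1.1.1 j) (w.1.2.1 j))
      ((((anglePi κ).prod (anglePi ι)).prod ((anglePi κ).prod (anglePi ι))).prod
        stdComplexGaussian) := by
  set M := 4 * ((√(1 - s ^ 2))⁻¹ * Real.exp ((4 * s + 4 * s ^ 2) / (1 - s ^ 2))) with hM
  have hM0 : 0 ≤ M := by positivity
  clear_value M
  have hb : Integrable (fun ζ : ℂ => (M ^ Fintype.card ι * M ^ Fintype.card κ) *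
      Real.exp (0 * ‖ζ‖ ^ 2 + ((Fintype.card ι + Fintype.card κ) * (4 * √t)) * ‖ζ‖))
      stdComplexGaussian := (integrable_exp_quadratic_norm zero_lt_one _).const_mul _
  refine (hb.comp_snd (((anglePi κ).prod (anglePi ι)).prod
    ((anglePi κ).prod (anglePi ι)))).mono' ?_ (Filter.Eventually.of_forall fun w => ?_)
  · refine Continuous.aestronglyMeasurable (Continuous.mul ?_ ?_)
    · exact continuous_finsetProd _ fun i _ => (continuous_linearisedSite s).comp
        (f := fun w : (((κ → ℝ) × (ι → ℝ)) × ((κ → ℝ) × (ι → ℝ))) × ℂ =>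
          ((√t : ℂ) * w.2, w.1.1.2 i, w.1.2.2 i)) (by fun_prop)
    · exact continuous_finsetProd _ fun j _ => (continuous_linearisedSite s).comp
        (f := fun w : (((κ → ℝ) × (ι → ℝ)) × ((κ → ℝ) × (ι → ℝ))) × ℂ =>
          ((√t : ℂ) * conj w.2, w.1.1.1 j, w.1.2.1 j)) (by fun_prop)
  · have h1 : ‖(√t : ℂ)‖ = √t := by simp [abs_of_nonneg (Real.sqrt_nonneg t)]
    rw [norm_mul, norm_prod, norm_prod]
    have hι : ∏ i, ‖linearisedSite s (√t * w.2) (w.1.1.2 i) (w.1.2.2 i)‖ ≤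
        ∏ _i : ι, M * Real.exp (4 * (√t * ‖w.2‖)) := by
      refine Finset.prod_le_prod (fun _ _ => norm_nonneg _) fun i _ => ?_
      have := norm_linearisedSite_le hs hs1 (√t * w.2) (w.1.1.2 i) (w.1.2.2 i)
      rwa [norm_mul, h1, ← hM] at this
    have hκ : ∏ j, ‖linearisedSite s (√t * conj w.2) (w.1.1.1 j) (w.1.2.1 j)‖ ≤
        ∏ _j : κ, M * Real.exp (4 * (√t * ‖w.2‖)) := by
      refine Finset.prod_le_prod (fun _ _ => norm_nonneg _) fun j _ => ?_
      have := norm_linearisedSite_le hs hs1 (√t * conj w.2) (w.1.1.1 j) (w.1.2.1 j)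
      rwa [norm_mul, h1, RCLike.norm_conj, ← hM] at this
    refine (mul_le_mul hι hκ (Finset.prod_nonneg fun _ _ => norm_nonneg _)
      (Finset.prod_nonneg fun _ _ => by positivity)).trans (le_of_eq ?_)
    rw [Finset.prod_const, Finset.prod_const, Finset.card_univ, Finset.card_univ, mul_pow, mul_pow,
      mul_mul_mul_comm, ← pow_add (Real.exp _), ← Real.exp_nat_mul]
    congr 2
    push_cast
    ring

theorem integral_angle_linearisedSite {s : ℝ} (hs : 0 ≤ s) (hs1 : s < 1) (u v : ℂ) :
    ∫ z : ((κ → ℝ) × (ι → ℝ)) × ((κ → ℝ) × (ι → ℝ)),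
      (∏ i, linearisedSite s u (z.1.2 i) (z.2.2 i)) *
        ∏ j, linearisedSite s v (z.1.1 j) (z.2.1 j)
      ∂(((anglePi κ).prod (anglePi ι)).prod ((anglePi κ).prod (anglePi ι))) =
    siteFactor s u ^ Fintype.card ι * siteFactor s v ^ Fintype.card κ := by
  rw [integral_prod]
  · have h1 : ∀ p : (κ → ℝ) × (ι → ℝ), ∫ p' : (κ → ℝ) × (ι → ℝ),
        (∏ i, linearisedSite s u (p.2 i) (p'.2 i)) * ∏ j, linearisedSite s v (p.1 j) (p'.1 j)
          ∂((anglePi κ).prod (anglePi ι)) =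
        (∫ φ', ∏ j, linearisedSite s v (p.1 j) (φ' j) ∂anglePi κ) *
          ∫ θ', ∏ i, linearisedSite s u (p.2 i) (θ' i) ∂anglePi ι := by
      intro p
      rw [← integral_prod_mul]
      simp only [mul_comm]
    simp only [h1]
    rw [integral_prod_mul (fun φ : κ → ℝ => ∫ φ', ∏ j, linearisedSite s v (φ j) (φ' j) ∂anglePi κ)
      (fun θ : ι → ℝ => ∫ θ', ∏ i, linearisedSite s u (θ i) (θ' i) ∂anglePi ι),
      integral_integral_prod_eq_pow, integral_integral_prod_eq_pow]
    simp only [linearisedSite, integral_siteKernel hs hs1]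
    rw [mul_comm]
  · refine Integrable.of_bound (C := (∏ _i : ι, 4 * ((√(1 - s ^ 2))⁻¹ *
      Real.exp ((4 * s + 4 * s ^ 2) / (1 - s ^ 2))) * Real.exp (4 * ‖u‖)) *
        ∏ _j : κ, 4 * ((√(1 - s ^ 2))⁻¹ * Real.exp ((4 * s + 4 * s ^ 2) / (1 - s ^ 2))) *
          Real.exp (4 * ‖v‖)) (Continuous.aestronglyMeasurable (Continuous.mul ?_ ?_))
        (Filter.Eventually.of_forall fun z => ?_)
    · exact continuous_finsetProd _ fun i _ => (continuous_linearisedSite s).comp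
        (f := fun z : ((κ → ℝ) × (ι → ℝ)) × ((κ → ℝ) × (ι → ℝ)) =>
          (u, z.1.2 i, z.2.2 i)) (by fun_prop)
    · exact continuous_finsetProd _ fun j _ => (continuous_linearisedSite s).comp
        (f := fun z : ((κ → ℝ) × (ι → ℝ)) × ((κ → ℝ) × (ι → ℝ)) =>
          (v, z.1.1 j, z.2.1 j)) (by fun_prop)
    · rw [norm_mul, norm_prod, norm_prod]
      exact mul_le_mul
        (Finset.prod_le_prod (fun _ _ => norm_nonneg _) fun i _ =>
          norm_linearisedSite_le hs hs1 u _ _)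
        (Finset.prod_le_prod (fun _ _ => norm_nonneg _) fun j _ =>
          norm_linearisedSite_le hs hs1 v _ _)
        (Finset.prod_nonneg fun _ _ => norm_nonneg _)
        (Finset.prod_nonneg fun _ _ => by positivity)

/-- The second moment of `decoupledF` reduces to an integral over one complex Gaussian variable. -/
theorem lintegral_decoupledF_le [DecidableEq ι] [DecidableEq κ] {s t : ℝ} (hs : 0 ≤ s)
    (hs1 : s < 1) (ht : 0 ≤ t) :
    ∫⁻ q : ((ι → ℂ) × (κ → ℂ)) × (ι × κ → ℂ),
      ‖decoupledF ((√s : ℂ) • q.1.1) ((√s : ℂ) • q.1.2) ((√t : ℂ) • q.2)‖ₑ ^ 2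
      ∂(((stdComplexGaussianPi ι).prod (stdComplexGaussianPi κ)).prod
        (stdComplexGaussianPi (ι × κ))) ≤
    ∫⁻ ζ, ‖siteFactor s (√t * ζ) ^ Fintype.card ι *
      siteFactor s (√t * conj ζ) ^ Fintype.card κ‖ₑ ∂stdComplexGaussian := by
  have h := lintegral_enorm_integral_sq_le
    (τ := (anglePi κ).prod (anglePi ι))
    (P := ((stdComplexGaussianPi ι).prod (stdComplexGaussianPi κ)).prod
        (stdComplexGaussianPi (ι × κ)))
    (continuous_replicaIntegrand s t).measurable
    (fun p q => norm_replicaIntegrand_le hs t p q) (integrable_replicaBound_sq hs1 t)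
  simp only [integral_replicaIntegrand hs t, integral_replicaIntegrand_mul_conj hs hs1 ht,
    ← integral_linearisedSite ht] at h
  rw [integral_integral_swap (integrable_linearisedSite hs hs1 t)] at h
  simp only [integral_angle_linearisedSite hs hs1] at h
  exact h.trans (enorm_integral_le_lintegral_enorm _)

end Replica

/-! ### Third-order bound for the vertex factor -/

theorem inv_sqrt_one_sub_sq_le {s : ℝ} (hs : 0 ≤ s) (hs1 : s ≤ 1 / 10) :
    (√(1 - s ^ 2))⁻¹ ≤ 1 + s ^ 2 / 2 + s ^ 3 := by
  have h0 : 0 < 1 - s ^ 2 := by nlinarith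
  have hb : 0 < 1 + s ^ 2 / 2 + s ^ 3 := by positivity
  rw [inv_le_comm₀ (Real.sqrt_pos.2 h0) hb]
  refine Real.le_sqrt_of_sq_le ?_
  rw [inv_pow, inv_le_comm₀ (by positivity) h0]
  have h3 : 0 ≤ s ^ 3 := by positivity
  have h4 : s ^ 2 * s ^ 3 ≤ 1 / 100 * s ^ 3 :=
    mul_le_mul_of_nonneg_right (by nlinarith) h3
  rw [inv_le_iff_one_le_mul₀ h0]
  have h6 : s ^ 4 ≤ 1 / 10 * s ^ 3 := by nlinarith
  have h7 : 0 ≤ s ^ 6 := by positivity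
  have h8 : s ^ 2 * s ^ 6 ≤ 1 / 100 * s ^ 6 := mul_le_mul_of_nonneg_right (by nlinarith) h7
  have h9 : s ^ 6 ≤ 1 / 1000 * s ^ 3 := by
    have : s ^ 3 ≤ 1 / 1000 := by
      have := pow_le_pow_left₀ hs hs1 3
      norm_num at this ⊢; linarith
    nlinarith
  nlinarith

/-- Third order expansion of the interaction part of `siteFactor`. -/
theorem norm_exp_mul_sub_le {v : ℂ} (hv : ‖v‖ ≤ 1) {σ : ℝ} (hσ : 0 ≤ σ) :
    ‖cexp v * (1 - v + v ^ 2 - σ) - (1 + v ^ 2 / 2 - σ)‖ ≤ 4 * ‖v‖ ^ 3 + 2 * σ * ‖v‖ := by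
  have hE : ‖cexp v - (1 + v + v ^ 2 / 2)‖ ≤ ‖v‖ ^ 3 := by
    have h := Complex.exp_bound hv (n := 3) (by norm_num)
    simp only [Finset.sum_range_succ, Finset.sum_range_zero, Nat.factorial] at h
    norm_num at h
    refine h.trans ?_
    have : 0 ≤ ‖v‖ ^ 3 := by positivity
    linarith
  have hE1 : ‖cexp v - 1‖ ≤ 2 * ‖v‖ := Complex.norm_exp_sub_one_le hv
  have h1 : cexp v * (1 - v + v ^ 2 - σ) - (1 + v ^ 2 / 2 - σ) =
      (v ^ 3 / 2 + v ^ 4 / 2) + (cexp v - (1 + v + v ^ 2 / 2)) * (1 - v + v ^ 2) -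
        σ * (cexp v - 1) := by ring
  have hv2 : ‖v‖ ^ 2 ≤ 1 := pow_le_one₀ (norm_nonneg _) hv
  have hv4 : ‖v‖ ^ 4 ≤ ‖v‖ ^ 3 := pow_le_pow_of_le_one (norm_nonneg _) hv (by norm_num)
  have h2 : ‖v ^ 3 / 2 + v ^ 4 / 2‖ ≤ ‖v‖ ^ 3 := by
    refine (norm_add_le _ _).trans ?_
    rw [norm_div, norm_div, norm_pow, norm_pow, Complex.norm_ofNat]
    linarith
  have h3 : ‖1 - v + v ^ 2‖ ≤ 3 := by
    refine (norm_add_le _ _).trans ?_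
    have := norm_sub_le 1 v
    rw [norm_one] at this
    rw [norm_pow]
    linarith
  have h4 : ‖(cexp v - (1 + v + v ^ 2 / 2)) * (1 - v + v ^ 2)‖ ≤ ‖v‖ ^ 3 * 3 := by
    rw [norm_mul]
    exact mul_le_mul hE h3 (norm_nonneg _) (by positivity)
  have h5 : ‖σ * (cexp v - 1)‖ ≤ σ * (2 * ‖v‖) := by
    rw [norm_mul, Complex.norm_real, Real.norm_of_nonneg hσ]
    exact mul_le_mul_of_nonneg_left hE1 hσ
  rw [h1]
  refine (norm_sub_le _ _).trans ?_
  have := norm_add_le (v ^ 3 / 2 + v ^ 4 / 2)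
    ((cexp v - (1 + v + v ^ 2 / 2)) * (1 - v + v ^ 2))
  linarith

/-- Since `exp v * (1 - v + v²) = 1 + v² / 2 + O(v³)`, there is no linear term. At `u = 0` the
bracket is `1 + s² / 2 - s² + O(s³)`, and its `-s² / 2` cancels the `+s² / 2` of the prefactor `(1 -
s²)^(-1/2)`. This cancellation is what finally yields `n⁴|z|⁶`; terms involving `u` need only be of
second order in `(s, u)`. -/
theorem norm_siteFactor_le {s : ℝ} (hs : 0 ≤ s) (hs1 : s ≤ 1 / 10) (u : ℂ) :
    ‖siteFactor s u‖ ≤ Real.exp (60 * (s ^ 3 + s * ‖u‖ + ‖u‖ ^ 2)) := by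
  have h1s : 0 < 1 - s := by linarith
  have h0 : 0 < 1 - s ^ 2 := by nlinarith
  set p : ℝ := s / (1 - s) with hp
  set σ : ℝ := s ^ 2 / (1 - s ^ 2) with hσ
  set D : ℝ := (√(1 - s ^ 2))⁻¹ with hD
  have hD0 : 0 ≤ D := by positivity
  have hD1 : D ≤ 1 + s ^ 2 / 2 + s ^ 3 := inv_sqrt_one_sub_sq_le hs hs1
  have hs2 : s ^ 2 ≤ 1 / 10 * s := by nlinarith
  have hs3 : s ^ 3 ≤ 1 / 10 * s ^ 2 := by nlinarith [sq_nonneg s]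
  have hs3' : 0 ≤ s ^ 3 := by positivity
  have hp0 : 0 ≤ p := by positivity
  have hp1 : p ≤ 10 / 9 * s := by
    rw [hp, div_le_iff₀ h1s]; nlinarith
  have hσ0 : 0 ≤ σ := by positivity
  have hσ1 : s ^ 2 ≤ σ := by
    rw [hσ, le_div_iff₀ h0]; nlinarith [sq_nonneg (s ^ 2)]
  have hσ2 : σ ≤ 100 / 99 * s ^ 2 := by
    rw [hσ, div_le_iff₀ h0]; nlinarith [sq_nonneg s]
  have hp2 : p ^ 2 ≤ s ^ 2 + 3 * s ^ 3 := by
    rw [hp, div_pow, div_le_iff₀ (by positivity)]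
    nlinarith [mul_nonneg hs3' (by nlinarith : (0 : ℝ) ≤ 1 - 5 * s + 3 * s ^ 2)]
  have hsf : siteFactor s u = (D : ℂ) * (cexp (p + u) * (1 - (p + u) + (p + u) ^ 2 - σ)) := by
    rw [siteFactor, hp, hσ, hD]
    push_cast
    rfl
  have hpu : ‖(p + u : ℂ)‖ ≤ p + ‖u‖ := by
    refine (norm_add_le _ _).trans ?_
    rw [Complex.norm_real, Real.norm_of_nonneg hp0]
  rw [hsf, norm_mul, Complex.norm_real, Real.norm_of_nonneg hD0]
  set v : ℂ := p + u with hv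
  have hu0 := norm_nonneg u
  have hv0 := norm_nonneg v
  -- Taylor expansion is used for small `u`. For `‖u‖ > 1 / 2` a crude exponential bound suffices,
  -- because constants and `‖u‖` are then dominated by `‖u‖²`.
  rcases le_or_gt ‖u‖ (1 / 2) with hu | hu
  · have hv1 : ‖v‖ ≤ 1 := by linarith
    have h1 := norm_exp_mul_sub_le hv1 hσ0
    have h2 : ‖(1 + v ^ 2 / 2 - σ : ℂ)‖ ≤ (1 + p ^ 2 / 2 - σ) + p * ‖u‖ + ‖u‖ ^ 2 / 2 := by
      have e : (1 + v ^ 2 / 2 - σ : ℂ) = ((1 + p ^ 2 / 2 - σ : ℝ) : ℂ) + p * u + u ^ 2 / 2 := by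
        rw [hv]; push_cast; ring
      rw [e]
      refine (norm_add_le _ _).trans (add_le_add ((norm_add_le _ _).trans (add_le_add ?_ ?_)) ?_)
      · rw [Complex.norm_real, Real.norm_of_nonneg]
        have := sq_nonneg p
        linarith
      · rw [norm_mul, Complex.norm_real, Real.norm_of_nonneg hp0]
      · rw [norm_div, norm_pow, Complex.norm_ofNat]
    have h3 : ‖cexp v * (1 - v + v ^ 2 - σ)‖ ≤
        (1 + p ^ 2 / 2 - σ) + p * ‖u‖ + ‖u‖ ^ 2 / 2 + (4 * ‖v‖ ^ 3 + 2 * σ * ‖v‖) := by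
      have := norm_add_le (1 + v ^ 2 / 2 - σ : ℂ)
        (cexp v * (1 - v + v ^ 2 - σ) - (1 + v ^ 2 / 2 - σ))
      rw [add_sub_cancel] at this
      linarith
    have hv3 : ‖v‖ ^ 3 ≤ 4 * (p ^ 3 + ‖u‖ ^ 3) := by
      refine (pow_le_pow_left₀ hv0 hpu 3).trans ?_
      nlinarith [mul_nonneg (add_nonneg hp0 hu0) (sq_nonneg (p - ‖u‖))]
    have hu3 : ‖u‖ ^ 3 ≤ 1 / 2 * ‖u‖ ^ 2 := by nlinarith [sq_nonneg ‖u‖]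
    have hp3 : p ^ 3 ≤ 3 / 2 * s ^ 3 := by
      refine (pow_le_pow_left₀ hp0 hp1 3).trans ?_
      rw [mul_pow]
      have : ((10 : ℝ) / 9) ^ 3 ≤ 3 / 2 := by norm_num
      exact mul_le_mul_of_nonneg_right this hs3'
    have hσv : σ * ‖v‖ ≤ 2 * s ^ 3 + s * ‖u‖ := by
      have ha : σ * ‖v‖ ≤ (100 / 99 * s ^ 2) * (10 / 9 * s + ‖u‖) :=
        mul_le_mul hσ2 (by linarith) hv0 (by positivity)
      have hb : s ^ 2 * ‖u‖ ≤ 1 / 10 * s * ‖u‖ := mul_le_mul_of_nonneg_right hs2 hu0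
      have hc : (100 / 99 * s ^ 2) * (10 / 9 * s + ‖u‖) =
          1000 / 891 * s ^ 3 + 100 / 99 * (s ^ 2 * ‖u‖) := by ring
      have hd := mul_nonneg hs hu0
      linarith
    have hpu' : p * ‖u‖ ≤ 10 / 9 * s * ‖u‖ := mul_le_mul_of_nonneg_right hp1 hu0
    have hsu : 0 ≤ s * ‖u‖ := by positivity
    have hmain : ‖cexp v * (1 - v + v ^ 2 - σ)‖ ≤
        (1 - s ^ 2 / 2 + 3 / 2 * s ^ 3) + 28 * (s ^ 3 + s * ‖u‖ + ‖u‖ ^ 2) := by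
      have := sq_nonneg ‖u‖
      linarith
    have hD2 : D ≤ 2 := by linarith
    -- The second-order cancellation takes place in this product.
    have hD3 : D * (1 - s ^ 2 / 2 + 3 / 2 * s ^ 3) ≤
        1 + 3 * (s ^ 3 + s * ‖u‖ + ‖u‖ ^ 2) := by
      have ha : D * (1 - s ^ 2 / 2 + 3 / 2 * s ^ 3) ≤
          (1 + s ^ 2 / 2 + s ^ 3) * (1 - s ^ 2 / 2 + 3 / 2 * s ^ 3) :=
        mul_le_mul_of_nonneg_right hD1 (by linarith)
      have hb : (1 + s ^ 2 / 2 + s ^ 3) * (1 - s ^ 2 / 2 + 3 / 2 * s ^ 3) =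
          1 + 5 / 2 * s ^ 3 - s ^ 3 * (s / 4 - s ^ 2 / 4 - 3 / 2 * s ^ 3) := by ring
      have hc : 0 ≤ s / 4 - s ^ 2 / 4 - 3 / 2 * s ^ 3 := by linarith
      have hd := mul_nonneg hs3' hc
      have he := sq_nonneg ‖u‖
      linarith
    have hX : 0 ≤ s ^ 3 + s * ‖u‖ + ‖u‖ ^ 2 := by positivity
    calc D * ‖cexp v * (1 - v + v ^ 2 - σ)‖
        ≤ D * ((1 - s ^ 2 / 2 + 3 / 2 * s ^ 3) + 28 * (s ^ 3 + s * ‖u‖ + ‖u‖ ^ 2)) :=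
          mul_le_mul_of_nonneg_left hmain hD0
      _ ≤ 60 * (s ^ 3 + s * ‖u‖ + ‖u‖ ^ 2) + 1 := by
          have : D * (28 * (s ^ 3 + s * ‖u‖ + ‖u‖ ^ 2)) ≤
            2 * (28 * (s ^ 3 + s * ‖u‖ + ‖u‖ ^ 2)) :=
            mul_le_mul_of_nonneg_right hD2 (by positivity)
          have he := sq_nonneg ‖u‖
          rw [mul_add]
          linarith
      _ ≤ _ := Real.add_one_le_exp _
  · have hvu : ‖v‖ ≤ 2 * ‖u‖ := by linarith
    have hexp : 1 + ‖v‖ + ‖v‖ ^ 2 / 2 ≤ Real.exp ‖v‖ := Real.quadratic_le_exp_of_nonneg hv0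
    have h1 : ‖(1 - v + v ^ 2 - σ : ℂ)‖ ≤ 3 * Real.exp ‖v‖ := by
      refine (norm_sub_le _ _).trans ?_
      have ha := norm_add_le (1 - v) (v ^ 2)
      have hb := norm_sub_le 1 v
      rw [norm_one] at hb
      rw [norm_pow] at ha
      rw [Complex.norm_real, Real.norm_of_nonneg hσ0]
      have hc := sq_nonneg ‖v‖
      linarith
    have h2 : D * ‖cexp v * (1 - v + v ^ 2 - σ)‖ ≤
        2 * (Real.exp ‖v‖ * (3 * Real.exp ‖v‖)) := by
      rw [norm_mul]
      refine mul_le_mul (by linarith) ?_ (by positivity) (by norm_num)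
      exact mul_le_mul (Complex.norm_exp_le_exp_norm v) h1 (norm_nonneg _) (by positivity)
    have h6 : (6 : ℝ) ≤ Real.exp 2 := by
      have := Real.exp_one_gt_d9
      have e : Real.exp 2 = Real.exp 1 * Real.exp 1 := by rw [← Real.exp_add]; norm_num
      rw [e]; nlinarith
    refine h2.trans ?_
    calc 2 * (Real.exp ‖v‖ * (3 * Real.exp ‖v‖)) = 6 * (Real.exp ‖v‖ * Real.exp ‖v‖) := by ring
      _ ≤ Real.exp 2 * (Real.exp ‖v‖ * Real.exp ‖v‖) :=
          mul_le_mul_of_nonneg_right h6 (by positivity)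
      _ = Real.exp (2 + (‖v‖ + ‖v‖)) := by rw [Real.exp_add, Real.exp_add]
      _ ≤ _ := by
          refine Real.exp_le_exp.2 ?_
          have hsu := mul_nonneg hs hu0
          have huu : ‖u‖ ≤ 2 * ‖u‖ ^ 2 := by nlinarith only [hu]
          linarith

/-- The `2n` vertex factors give exponent `120 n (s³ + s √t |ζ| + t |ζ|²)`. From `n t ≤ s ≤ 1 / 480`
the last term is at most `|ζ|² / 4`. The cross term is at most `(120 s n √t)² + |ζ|² / 4`, hence at
most `14400 n s³ + |ζ|² / 4`. Altogether this is `14520 n s³ + |ζ|² / 2`, integrable against the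
Gaussian. -/
theorem norm_siteFactor_pow_mul_le {n : ℕ} {s t : ℝ} (ht : 0 ≤ t) (hs1 : s ≤ 1 / 480)
    (hts : n * t ≤ s) (ζ : ℂ) :
    ‖siteFactor s (√t * ζ) ^ n * siteFactor s (√t * conj ζ) ^ n‖ ≤
      Real.exp (14520 * n * s ^ 3) * Real.exp (1 / 2 * ‖ζ‖ ^ 2) := by
  have hs : 0 ≤ s := le_trans (by positivity) hts
  have hn : (0 : ℝ) ≤ n := Nat.cast_nonneg n
  have h1 : ‖(√t : ℂ)‖ = √t := by simp [abs_of_nonneg (Real.sqrt_nonneg t)]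
  have hu : ∀ w : ℂ, ‖w‖ = ‖ζ‖ → ‖siteFactor s (√t * w)‖ ≤
      Real.exp (60 * (s ^ 3 + s * (√t * ‖ζ‖) + t * ‖ζ‖ ^ 2)) := by
    intro w hw
    have := norm_siteFactor_le hs (by linarith) (√t * w)
    rwa [norm_mul, h1, hw, mul_pow, Real.sq_sqrt ht] at this
  rw [norm_mul, norm_pow, norm_pow]
  refine (mul_le_mul (pow_le_pow_left₀ (norm_nonneg _) (hu ζ rfl) n)
    (pow_le_pow_left₀ (norm_nonneg _) (hu (conj ζ) (RCLike.norm_conj ζ)) n)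
    (by positivity) (by positivity)).trans ?_
  rw [← Real.exp_nat_mul, ← Real.exp_add, ← Real.exp_add]
  refine Real.exp_le_exp.2 ?_
  have hz := norm_nonneg ζ
  have e1 : (n : ℝ) * t * ‖ζ‖ ^ 2 ≤ s * ‖ζ‖ ^ 2 := by gcongr
  have e2 : s * ‖ζ‖ ^ 2 ≤ 1 / 480 * ‖ζ‖ ^ 2 := by gcongr
  have e3 : (n * √t) ^ 2 ≤ n * s := by
    rw [mul_pow, Real.sq_sqrt ht, sq, mul_assoc]; gcongr
  have e4 : (120 * s) ^ 2 * (n * √t) ^ 2 ≤ (120 * s) ^ 2 * (n * s) := by gcongr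
  nlinarith [sq_nonneg (120 * s * (n * √t) - 1 / 2 * ‖ζ‖)]

/-! ### From the matrix to independent row sums, column sums and entries -/

theorem measurable_decoupledF {E ι κ : Type*} [NormedAddCommGroup E] [NormedSpace ℂ E]
    [MeasurableSpace E] [OpensMeasurableSpace E] [Fintype ι] [Fintype κ] [DecidableEq ι]
    [DecidableEq κ] {R : E → ι → ℂ} {C : E → κ → ℂ} {x : E → ι × κ → ℂ} (hR : Differentiable ℂ R)
    (hC : Differentiable ℂ C) (hx : Differentiable ℂ x) :
    Measurable fun v => decoupledF (R v) (C v) (x v) :=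
  (hR.decoupledF hC hx).continuous.measurable

section

variable {ι κ : Type*} [Fintype ι] [Fintype κ] [DecidableEq ι] [DecidableEq κ]

/-- Separating the row sums, the column sums and the entries of a Gaussian matrix. -/
theorem lintegral_decoupledF_rowSum_colSum_le (r : ℝ) :
    ∫⁻ x : ι × κ → ℂ, ‖decoupledF (fun i => ∑ j, ((r : ℂ) • x) (i, j))
      (fun j => ∑ i, ((r : ℂ) • x) (i, j)) ((r : ℂ) • x)‖ₑ ^ 2 ∂stdComplexGaussianPi (ι × κ) ≤
    ∫⁻ y, ∫⁻ x, ∫⁻ x', ‖decoupledF (fun i => ∑ j, ((2 * r : ℂ) • x) (i, j))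
      (fun j => ∑ i, ((2 * r : ℂ) • x') (i, j)) (((√2 : ℂ) * r) • y)‖ₑ ^ 2
      ∂stdComplexGaussianPi (ι × κ) ∂stdComplexGaussianPi (ι × κ)
      ∂stdComplexGaussianPi (ι × κ) := by
  have hsq : (√2 : ℂ) * √2 = 2 := by
    rw [← Complex.ofReal_mul, Real.mul_self_sqrt (by norm_num)]; norm_num
  have h1 := lintegral_diagonal_le (ι := ι × κ) (f := fun y x =>
    decoupledF (fun i => ∑ j, ((r : ℂ) • x) (i, j)) (fun j => ∑ i, ((r : ℂ) • x) (i, j))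
      ((r : ℂ) • y)) (Differentiable.decoupledF
        (by simp only [Pi.smul_apply]; fun_prop) (by simp only [Pi.smul_apply]; fun_prop)
        (by fun_prop))
  refine h1.trans (lintegral_mono fun y => ?_)
  -- The first decoupling freed the entries `y`. The second separates row sums from column sums, so
  -- these two carry `√2 * √2 = 2` and the entries only `√2`.
  have h2 := lintegral_diagonal_le (ι := ι × κ) (f := fun x x' =>
    decoupledF (fun i => ∑ j, (((√2 : ℂ) * r) • x) (i, j))
      (fun j => ∑ i, (((√2 : ℂ) * r) • x') (i, j)) (((√2 : ℂ) * r) • y))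
      (Differentiable.decoupledF
        (by simp only [Pi.smul_apply]; fun_prop) (by simp only [Pi.smul_apply]; fun_prop)
        (by fun_prop))
  simp only [smul_smul] at h2 ⊢
  have e1 : (√2 : ℂ) * r * √2 = 2 * r := by linear_combination (r : ℂ) * hsq
  have e2 : (r : ℂ) * √2 = √2 * r := mul_comm _ _
  simp only [e1] at h2
  simp only [e2]
  exact h2

/-- Once they come from different copies of the matrix, the row sums and the column sums enter only
through their laws: vectors of independent Gaussians of variance `a²` times the common side length.
-/
theorem lintegral_decoupledF_rowSum_colSum_eq (a b : ℝ) (ha : 0 ≤ a) (hb : 0 ≤ b)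
    (hικ : Fintype.card κ = Fintype.card ι) :
    ∫⁻ y, ∫⁻ x, ∫⁻ x', ‖decoupledF (fun i => ∑ j, ((a : ℂ) • x) (i, j))
      (fun j => ∑ i, ((a : ℂ) • x') (i, j)) ((b : ℂ) • y)‖ₑ ^ 2
      ∂stdComplexGaussianPi (ι × κ) ∂stdComplexGaussianPi (ι × κ)
      ∂stdComplexGaussianPi (ι × κ) =
    ∫⁻ q : ((ι → ℂ) × (κ → ℂ)) × (ι × κ → ℂ),
      ‖decoupledF ((√(a ^ 2 * Fintype.card ι) : ℂ) • q.1.1) ((√(a ^ 2 * Fintype.card ι) : ℂ) • q.1.2)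
        ((√(b ^ 2) : ℂ) • q.2)‖ₑ ^ 2
      ∂(((stdComplexGaussianPi ι).prod (stdComplexGaussianPi κ)).prod
        (stdComplexGaussianPi (ι × κ))) := by
  have hs : √(a ^ 2 * Fintype.card ι) = a * √(Fintype.card ι) := by
    rw [Real.sqrt_mul (by positivity), Real.sqrt_sq ha]
  rw [hs, Real.sqrt_sq hb]
  have hrow : ∀ (C : κ → ℂ) (y : ι × κ → ℂ), ∫⁻ x : ι × κ → ℂ,
      ‖decoupledF (fun i => ∑ j, ((a : ℂ) • x) (i, j)) C y‖ₑ ^ 2 ∂stdComplexGaussianPi (ι × κ) =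
      ∫⁻ w : ι → ℂ, ‖decoupledF (((a * √(Fintype.card ι) : ℝ) : ℂ) • w) C y‖ₑ ^ 2
        ∂stdComplexGaussianPi ι := by
    intro C y
    have hm : Measurable fun w : ι → ℂ => ‖decoupledF ((a : ℂ) • w) C y‖ₑ ^ 2 :=
      (measurable_decoupledF (by fun_prop) (by fun_prop) (by fun_prop)).enorm.pow_const 2
    have h := congrArg (fun μ => ∫⁻ w, ‖decoupledF ((a : ℂ) • w) C y‖ₑ ^ 2 ∂μ)
      (map_rowSum_stdComplexGaussianPi (ι := ι) (κ := κ))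
    rw [lintegral_map hm (by fun_prop), lintegral_map hm (by fun_prop), hικ] at h
    refine Eq.trans ?_ (h.trans ?_)
    · refine lintegral_congr fun x => ?_
      congr 3
      ext i
      simp [Finset.mul_sum]
    · refine lintegral_congr fun w => ?_
      congr 3
      ext i
      simp [mul_assoc]
  have hcol : ∀ (R : ι → ℂ) (y : ι × κ → ℂ), ∫⁻ x : ι × κ → ℂ,
      ‖decoupledF R (fun j => ∑ i, ((a : ℂ) • x) (i, j)) y‖ₑ ^ 2 ∂stdComplexGaussianPi (ι × κ) =
      ∫⁻ w : κ → ℂ, ‖decoupledF R (((a * √(Fintype.card ι) : ℝ) : ℂ) • w) y‖ₑ ^ 2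
        ∂stdComplexGaussianPi κ := by
    intro R y
    have hm : Measurable fun w : κ → ℂ => ‖decoupledF R ((a : ℂ) • w) y‖ₑ ^ 2 :=
      (measurable_decoupledF (by fun_prop) (by fun_prop) (by fun_prop)).enorm.pow_const 2
    have h := congrArg (fun μ => ∫⁻ w, ‖decoupledF R ((a : ℂ) • w) y‖ₑ ^ 2 ∂μ)
      (map_colSum_stdComplexGaussianPi (ι := ι) (κ := κ))
    rw [lintegral_map hm (by fun_prop), lintegral_map hm (by fun_prop)] at h
    refine Eq.trans ?_ (h.trans ?_)
    · refine lintegral_congr fun x => ?_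
      congr 3
      ext i
      simp [Finset.mul_sum]
    · refine lintegral_congr fun w => ?_
      congr 3
      ext i
      simp [mul_assoc]
  have hmq : Measurable fun q : ((ι → ℂ) × (κ → ℂ)) × (ι × κ → ℂ) =>
      ‖decoupledF (((a * √(Fintype.card ι) : ℝ) : ℂ) • q.1.1)
        (((a * √(Fintype.card ι) : ℝ) : ℂ) • q.1.2) ((b : ℂ) • q.2)‖ₑ ^ 2 :=
    (measurable_decoupledF (by fun_prop) (by fun_prop) (by fun_prop)).enorm.pow_const 2
  rw [lintegral_prod_symm _ hmq.aemeasurable]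
  refine lintegral_congr fun y => ?_
  have hmp : Measurable fun q : (ι → ℂ) × (κ → ℂ) =>
      ‖decoupledF (((a * √(Fintype.card ι) : ℝ) : ℂ) • q.1)
        (((a * √(Fintype.card ι) : ℝ) : ℂ) • q.2) ((b : ℂ) • y)‖ₑ ^ 2 :=
    (measurable_decoupledF (by fun_prop) (by fun_prop) (by fun_prop)).enorm.pow_const 2
  simp only
  rw [lintegral_prod_symm _ hmp.aemeasurable]
  simp only [hcol]
  rw [lintegral_lintegral_swap]
  · exact lintegral_congr fun w => hrow _ _
  · refine Measurable.aemeasurable ?_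
    exact (measurable_decoupledF (E := (ι × κ → ℂ) × (κ → ℂ))
      (R := fun p i => ∑ j, ((a : ℂ) • p.1) (i, j))
      (by simp only [Pi.smul_apply]; fun_prop) (by fun_prop) (by fun_prop)).enorm.pow_const 2

end

/-- Each entry contributes `(1 - r⁴)^(-1/2) ≤ exp (r⁴)`, and the `n²` entries together at most `exp
((n r²)²)`, which is bounded. -/
theorem lintegral_cexp_sum_sq_le {ι : Type*} [Fintype ι] {r : ℝ} (hr : Fintype.card ι * r ^ 2 ≤ 1 / 2) (hι : Nonempty ι) :
    ∫⁻ x : ι × ι → ℂ, ‖cexp (-(∑ e, ((r : ℂ) • x) e ^ 2) / 2)‖ₑ ^ 2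
      ∂stdComplexGaussianPi (ι × ι) ≤ ENNReal.ofReal (Real.exp 1) := by
  have hcard : (1 : ℝ) ≤ Fintype.card ι := by exact_mod_cast Fintype.card_pos
  have hr2 : r ^ 2 ≤ 1 / 2 := by nlinarith [sq_nonneg r]
  have hq : |(-r ^ 2)| < 1 := by rw [abs_neg, abs_of_nonneg (by positivity)]; linarith
  let f : ℂ → ℂ := fun w => cexp (((-r ^ 2 : ℝ) : ℂ) / 2 * w ^ 2 + 0 * w +
    (((-r ^ 2 : ℝ) : ℂ) / 2 * conj w ^ 2 + 0 * conj w))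
  have hf : ∫ w, f w ∂stdComplexGaussian = ((√(1 - (-r ^ 2) ^ 2))⁻¹ : ℝ) := by
    have := integral_cexp_quadratic_stdComplexGaussian hq 0 0
    simpa [f] using this
  have hnorm : ∀ x : ι × ι → ℂ,
      ((‖cexp (-(∑ e, ((r : ℂ) • x) e ^ 2) / 2)‖ ^ 2 : ℝ) : ℂ) = ∏ e, f (x e) := by
    intro x
    push_cast
    rw [← Complex.mul_conj', ← Complex.exp_conj, ← Complex.exp_add, ← Complex.exp_sum]
    congr 1
    simp only [map_div₀, map_neg, map_sum, map_pow, Pi.smul_apply, smul_eq_mul, map_mul,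
      conj_ofReal, map_ofNat, Finset.sum_add_distrib, ← Finset.mul_sum, mul_pow]
    push_cast
    simp only [zero_mul, add_zero]
    ring
  have hfi : Integrable f stdComplexGaussian := by
    by_contra hn
    rw [integral_undef hn] at hf
    have : (√(1 - (-r ^ 2) ^ 2))⁻¹ ≠ 0 := by
      have : 0 < 1 - (-r ^ 2) ^ 2 := by nlinarith [sq_nonneg r]
      positivity
    exact this (by exact_mod_cast hf.symm)
  have hint : Integrable (fun x : ι × ι → ℂ => ‖cexp (-(∑ e, ((r : ℂ) • x) e ^ 2) / 2)‖ ^ 2)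
      (stdComplexGaussianPi (ι × ι)) := by
    have h := Integrable.fintype_prod (ι := ι × ι) (μ := fun _ => stdComplexGaussian)
      (f := fun _ => f) fun _ => hfi
    refine (h.norm).congr (Filter.Eventually.of_forall fun x => ?_)
    simp only
    rw [← hnorm, Complex.norm_real, Real.norm_of_nonneg (by positivity)]
  have h1 : ∫⁻ x : ι × ι → ℂ, ‖cexp (-(∑ e, ((r : ℂ) • x) e ^ 2) / 2)‖ₑ ^ 2
      ∂stdComplexGaussianPi (ι × ι) =
      ENNReal.ofReal (∫ x : ι × ι → ℂ, ‖cexp (-(∑ e, ((r : ℂ) • x) e ^ 2) / 2)‖ ^ 2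
        ∂stdComplexGaussianPi (ι × ι)) := by
    rw [ofReal_integral_eq_lintegral_ofReal hint
      (Filter.Eventually.of_forall fun q => by positivity)]
    refine lintegral_congr fun q => ?_
    rw [← ofReal_norm, ENNReal.ofReal_pow (norm_nonneg _)]
  have h2 : ((∫ x : ι × ι → ℂ, ‖cexp (-(∑ e, ((r : ℂ) • x) e ^ 2) / 2)‖ ^ 2
        ∂stdComplexGaussianPi (ι × ι) : ℝ) : ℂ) =
      (((√(1 - (-r ^ 2) ^ 2))⁻¹ ^ Fintype.card (ι × ι) : ℝ) : ℂ) := by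
    rw [← integral_complex_ofReal]
    simp only [hnorm]
    rw [integral_fintype_prod_eq_prod (f := fun (_ : ι × ι) w => f w), hf]
    simp
  rw [h1, Complex.ofReal_injective h2]
  refine ENNReal.ofReal_le_ofReal ?_
  have h4 : (√(1 - (-r ^ 2) ^ 2))⁻¹ ≤ Real.exp (r ^ 4) := by
    have hpos : 0 < 1 - (-r ^ 2) ^ 2 := by nlinarith [sq_nonneg r]
    rw [inv_le_comm₀ (Real.sqrt_pos.2 hpos) (Real.exp_pos _), ← Real.exp_neg]
    refine Real.le_sqrt_of_sq_le ?_
    have e1 : Real.exp (-r ^ 4) ^ 2 = (Real.exp (2 * r ^ 4))⁻¹ := by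
      rw [← Real.exp_nat_mul, ← Real.exp_neg]; congr 1; push_cast; ring
    rw [e1, inv_le_comm₀ (Real.exp_pos _) hpos]
    refine le_trans ?_ (Real.add_one_le_exp _)
    rw [inv_le_iff_one_le_mul₀ hpos]
    have : r ^ 4 ≤ 1 / 4 := by nlinarith [sq_nonneg r]
    nlinarith [sq_nonneg r, sq_nonneg (r ^ 2), sq_nonneg (r ^ 4)]
  calc (√(1 - (-r ^ 2) ^ 2))⁻¹ ^ Fintype.card (ι × ι)
      ≤ Real.exp (r ^ 4) ^ Fintype.card (ι × ι) := pow_le_pow_left₀ (by positivity) h4 _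
    _ = Real.exp ((Fintype.card ι * r ^ 2) ^ 2) := by
        rw [← Real.exp_nat_mul, Fintype.card_prod]; congr 1; push_cast; ring
    _ ≤ Real.exp 1 := by
        refine Real.exp_le_exp.2 ?_
        have : 0 ≤ Fintype.card ι * r ^ 2 := by positivity
        nlinarith

theorem lintegral_exp_half_norm_sq_lt_top :
    ∫⁻ ζ, ENNReal.ofReal (Real.exp (1 / 2 * ‖ζ‖ ^ 2)) ∂stdComplexGaussian < ⊤ := by
  have h := integrable_exp_quadratic_norm (q := 1 / 2) (by norm_num) 0
  simp only [zero_mul, add_zero] at h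
  rw [← ofReal_integral_eq_lintegral_ofReal h (Filter.Eventually.of_forall fun _ => by positivity)]
  exact ENNReal.ofReal_lt_top

theorem lintegral_decoupledF_rowSum_colSum_le_exp {n : ℕ} (hn : 1 ≤ n) {r : ℝ} (hr : 0 ≤ r)
    (h : 4 * (n * r ^ 2) ≤ 1 / 480) :
    ∫⁻ x : Fin n × Fin n → ℂ, ‖decoupledF (fun i => ∑ j, ((r : ℂ) • x) (i, j))
      (fun j => ∑ i, ((r : ℂ) • x) (i, j)) ((r : ℂ) • x)‖ₑ ^ 2
        ∂stdComplexGaussianPi (Fin n × Fin n) ≤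
    ENNReal.ofReal (Real.exp (14520 * n * (4 * (n * r ^ 2)) ^ 3)) *
      ∫⁻ ζ, ENNReal.ofReal (Real.exp (1 / 2 * ‖ζ‖ ^ 2)) ∂stdComplexGaussian := by
  have hn' : (1 : ℝ) ≤ n := by exact_mod_cast hn
  refine (lintegral_decoupledF_rowSum_colSum_le r).trans ?_
  have h1 := lintegral_decoupledF_rowSum_colSum_eq (ι := Fin n) (κ := Fin n) (2 * r) (√2 * r)
    (by positivity) (by positivity) rfl
  push_cast at h1
  rw [h1]
  have hs : (2 * r) ^ 2 * (Fintype.card (Fin n)) = 4 * (n * r ^ 2) := by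
    rw [Fintype.card_fin]; ring
  have ht : (√2 * r) ^ 2 = 2 * r ^ 2 := by
    rw [mul_pow, Real.sq_sqrt (by norm_num)]
  rw [hs, ht]
  refine (lintegral_decoupledF_le (by positivity) (by linarith) (by positivity)).trans ?_
  rw [← lintegral_const_mul' _ _ ENNReal.ofReal_ne_top]
  refine lintegral_mono fun ζ => ?_
  rw [← ENNReal.ofReal_mul (Real.exp_pos _).le, ← ofReal_norm, Fintype.card_fin]
  exact ENNReal.ofReal_le_ofReal (norm_siteFactor_pow_mul_le (by positivity) h
    (by nlinarith [mul_nonneg (by linarith : (0:ℝ) ≤ n) (sq_nonneg r)]) ζ)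

/-- The Gaussian second moment of the reweighted matching polynomial, up to a constant factor. -/
theorem lintegral_hardcoreF2_lineGraphKnn_le {n : ℕ} (hn : 1 ≤ n) {r : ℝ} (hr : 0 ≤ r)
    (h : n * r ^ 2 ≤ 1 / 3840) :
    ∫⁻ x, ‖hardcoreF2 (lineGraphKnn n) ((r : ℂ) • x)‖ₑ ^ 2
      ∂stdComplexGaussianPi (Fin n × Fin n) ≤
    ENNReal.ofReal (Real.exp (14520 * n * (8 * (n * r ^ 2)) ^ 3)) *
      (∫⁻ ζ, ENNReal.ofReal (Real.exp (1 / 2 * ‖ζ‖ ^ 2)) ∂stdComplexGaussian) *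
        ENNReal.ofReal (Real.exp 1) := by
  have hsq : √2 ^ 2 = (2 : ℝ) := Real.sq_sqrt (by norm_num)
  -- Splitting off `exp (-∑ x² / 2)` costs one more `√2`, so the vertex parameter becomes `s = 8 n
  -- r²`; the threshold `1 / 3840` is `1 / (8 * 480)`.
  have h1 := lintegral_diagonal_le (ι := Fin n × Fin n) (f := fun x y =>
    decoupledF (fun i => ∑ j, ((r : ℂ) • x) (i, j)) (fun j => ∑ i, ((r : ℂ) • x) (i, j))
      ((r : ℂ) • x) * cexp (-(∑ e, ((r : ℂ) • y) e ^ 2) / 2))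
    (Differentiable.mul (Differentiable.decoupledF
        (by simp only [Pi.smul_apply]; fun_prop) (by simp only [Pi.smul_apply]; fun_prop)
        (by fun_prop)) (by simp only [Pi.smul_apply]; fun_prop))
  simp only [← hardcoreF2_lineGraphKnn_eq] at h1
  refine h1.trans ?_
  have e : ∀ x : Fin n × Fin n → ℂ, (r : ℂ) • (√2 : ℂ) • x = ((√2 * r : ℝ) : ℂ) • x := fun x => by
    rw [smul_smul, mul_comm]; push_cast; rfl
  have hcard : n * (√2 * r) ^ 2 = 2 * (n * r ^ 2) := by rw [mul_pow, hsq]; ring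
  simp only [e, enorm_mul, mul_pow (M := ENNReal)]
  have hexp := lintegral_cexp_sum_sq_le (ι := Fin n) (r := √2 * r)
    (by rw [Fintype.card_fin, hcard]; linarith) ⟨⟨0, hn⟩⟩
  have hdec := lintegral_decoupledF_rowSum_colSum_le_exp hn (r := √2 * r) (by positivity)
    (by rw [hcard]; linarith)
  rw [hcard, show 4 * (2 * (n * r ^ 2)) = 8 * (n * r ^ 2) by ring] at hdec
  calc _ ≤ ∫⁻ x : Fin n × Fin n → ℂ, ‖decoupledF (fun i => ∑ j, (((√2 * r : ℝ) : ℂ) • x) (i, j))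
        (fun j => ∑ i, (((√2 * r : ℝ) : ℂ) • x) (i, j)) (((√2 * r : ℝ) : ℂ) • x)‖ₑ ^ 2 *
          ENNReal.ofReal (Real.exp 1) ∂stdComplexGaussianPi (Fin n × Fin n) := by
        refine lintegral_mono fun x => ?_
        simp only
        rw [lintegral_const_mul' _ _ (by finiteness)]
        exact mul_le_mul' le_rfl hexp
    _ ≤ _ := by
        rw [lintegral_mul_const' _ _ ENNReal.ofReal_ne_top]
        exact mul_le_mul' hdec le_rfl

/-! ### Expansion of the reweighted partition function at the origin -/

section

variable {V : Type*} [Fintype V] (G : SimpleGraph V)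

/-- Independent pairs are the edges of the complement graph. Expanding `L₁²` over ordered pairs as
equal, adjacent or non-adjacent isolates them. -/
theorem sum_card_two_isIndepSet_eq
    [DecidablePred fun I : Finset V => G.IsIndepSet (I : Set V)] (x : V → ℂ) :
    ∑ I ∈ Finset.univ.powersetCard 2, (if G.IsIndepSet (I : Set V) then ∏ v ∈ I, x v else 0) =
      clusterL1 x ^ 2 / 2 + clusterL2 G x := by
  classical
  have h1 := G.sum_sum_adj_eq_two_mul_sum_edgeFinset fun p => (p.map x).mul
  have h2 := Gᶜ.sum_sum_adj_eq_two_mul_sum_edgeFinset fun p => (p.map x).mul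
  simp only [Sym2.map_mk, Sym2.mul_mk] at h1 h2
  have hadj : ∀ u v, x u * x v = (if G.Adj u v then x u * x v else 0) +
      (if Gᶜ.Adj u v then x u * x v else 0) + (if u = v then x u * x v else 0) := by
    intro u v
    by_cases h : u = v
    · simp [h]
    · by_cases h' : G.Adj u v <;> simp [h, h', SimpleGraph.compl_adj]
  have h3 : clusterL1 x ^ 2 = ∑ u, ∑ v, x u * x v := by
    rw [clusterL1, sq, Finset.sum_mul_sum]
  have h4 : ∑ u, ∑ v, (if u = v then x u * x v else 0) = ∑ v, x v ^ 2 := by simp [sq]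
  rw [Finset.sum_congr rfl fun u _ => Finset.sum_congr rfl fun v _ => hadj u v] at h3
  simp only [Finset.sum_add_distrib] at h3
  rw [h1, h2, h4] at h3
  have h5 : ∑ I ∈ Finset.univ.powersetCard 2,
      (if G.IsIndepSet (I : Set V) then ∏ v ∈ I, x v else 0) =
      ∑ p ∈ Gᶜ.edgeFinset, (p.map x).mul := by
    rw [← Finset.sum_filter]
    symm
    refine Finset.sum_bij (fun p _ => p.toFinset) ?_ ?_ ?_ ?_
    · intro p hp
      induction p using Sym2.ind with
      | _ u v =>
        have hp' : u ≠ v ∧ ¬ G.Adj u v := by simpa [SimpleGraph.compl_adj] using hp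
        rw [Sym2.toFinset_mk_eq]
        simp only [Finset.mem_filter, Finset.mem_powersetCard_univ, Finset.card_pair hp'.1,
          true_and, Finset.coe_insert, Finset.coe_singleton]
        intro a ha b hb hab
        rcases ha with rfl | rfl <;> rcases hb with rfl | rfl
        · exact absurd rfl hab
        · exact hp'.2
        · exact fun h => hp'.2 h.symm
        · exact absurd rfl hab
    · intro p _ q _ hpq
      refine Sym2.ext fun a => ?_
      rw [← Sym2.mem_toFinset, ← Sym2.mem_toFinset, hpq]
    · intro I hI
      simp only [Finset.mem_filter, Finset.mem_powersetCard_univ] at hI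
      obtain ⟨u, v, huv, rfl⟩ := Finset.card_eq_two.1 hI.1
      refine ⟨s(u, v), ?_, Sym2.toFinset_mk_eq⟩
      have := hI.2 (x := u) (by simp) (y := v) (by simp) huv
      simpa [SimpleGraph.compl_adj] using ⟨huv, this⟩
    · intro p hp
      induction p using Sym2.ind with
      | _ u v =>
        have hp' : u ≠ v ∧ ¬ G.Adj u v := by simpa [SimpleGraph.compl_adj] using hp
        rw [Sym2.toFinset_mk_eq, Finset.prod_pair hp'.1, Sym2.map_mk, Sym2.mul_mk]
  rw [h5, clusterL2]
  linear_combination (-1 / 2) * h3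

theorem prod_isBigO_norm_pow_card (I : Finset V) :
    (fun x : V → ℂ => ∏ v ∈ I, x v) =O[nhds 0] fun x => ‖x‖ ^ I.card := by
  refine Asymptotics.IsBigO.of_bound 1 (Filter.Eventually.of_forall fun x => ?_)
  rw [norm_prod, one_mul, norm_pow, norm_norm]
  exact (Finset.prod_le_prod (fun _ _ => norm_nonneg _) fun v _ => norm_le_pi_norm x v).trans_eq
    (by simp)

theorem norm_pow_isBigO_norm_pow {k l : ℕ} (h : k ≤ l) :
    (fun x : V → ℂ => ‖x‖ ^ l) =O[nhds 0] fun x => ‖x‖ ^ k := by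
  refine Asymptotics.IsBigO.of_bound 1 ?_
  filter_upwards [Metric.closedBall_mem_nhds (0 : V → ℂ) one_pos] with x hx
  simpa using pow_le_pow_of_le_one (norm_nonneg x) (by simpa using hx) h

theorem hardcoreZ_sub_isBigO :
    (fun x => hardcoreZ G x - (1 + clusterL1 x + (clusterL1 x ^ 2 / 2 + clusterL2 G x)))
      =O[nhds 0] fun x => ‖x‖ ^ 3 := by
  classical
  have key : ∀ x, hardcoreZ G x - (1 + clusterL1 x + (clusterL1 x ^ 2 / 2 + clusterL2 G x)) =
      ∑ I ∈ Finset.univ.filter (fun I : Finset V => 3 ≤ I.card),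
        if G.IsIndepSet (I : Set V) then ∏ v ∈ I, x v else 0 := by
    intro x
    let f : Finset V → ℂ := fun I => if G.IsIndepSet (I : Set V) then ∏ v ∈ I, x v else 0
    have e0 : ∑ I ∈ Finset.univ.powersetCard 0, f I = 1 := by simp [f]
    have e1 : ∑ I ∈ Finset.univ.powersetCard 1, f I = clusterL1 x := by
      simp [f, Finset.powersetCard_one, clusterL1]
    have e2 : ∑ I ∈ Finset.univ.powersetCard 2, f I = clusterL1 x ^ 2 / 2 + clusterL2 G x :=
      sum_card_two_isIndepSet_eq G x
    rw [hardcoreZ_eq_sum, ← e2, ← e1, ← e0, sub_eq_iff_eq_add']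
    change ∑ I, f I = _ + ∑ I ∈ _, f I
    rw [← Finset.sum_filter_add_sum_filter_not Finset.univ (fun I : Finset V => 3 ≤ I.card),
      add_comm]
    congr 1
    rw [← Finset.sum_union, ← Finset.sum_union]
    · refine Finset.sum_congr ?_ fun _ _ => rfl
      ext I
      simp only [Finset.mem_filter, Finset.mem_univ, true_and, Finset.mem_union,
        Finset.mem_powersetCard_univ]
      omega
    · rw [Finset.disjoint_left]
      intro I
      simp only [Finset.mem_union, Finset.mem_powersetCard_univ]
      omega
    · rw [Finset.disjoint_left]
      intro I
      simp only [Finset.mem_powersetCard_univ]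
      omega
  simp only [key]
  refine Asymptotics.IsBigO.fun_sum fun I hI => ?_
  by_cases h : G.IsIndepSet (I : Set V)
  · simp only [h, if_true]
    exact (prod_isBigO_norm_pow_card I).trans (norm_pow_isBigO_norm_pow (by simpa using hI))
  · simp only [h, if_false]
    exact Asymptotics.isBigO_zero _ _

theorem clusterL1_isBigO : (clusterL1 : (V → ℂ) → ℂ) =O[nhds 0] fun x => ‖x‖ := by
  unfold clusterL1
  refine Asymptotics.IsBigO.fun_sum fun v _ => ?_
  exact Asymptotics.IsBigO.of_bound 1 (Filter.Eventually.of_forall fun x => by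
    simpa using norm_le_pi_norm x v)

theorem clusterL2_isBigO : clusterL2 G =O[nhds 0] fun x => ‖x‖ ^ 2 := by
  unfold clusterL2
  refine Asymptotics.IsBigO.sub (Asymptotics.IsBigO.const_mul_left ?_ _) ?_
  · refine Asymptotics.IsBigO.fun_sum fun v _ => ?_
    refine Asymptotics.IsBigO.of_bound 1 (Filter.Eventually.of_forall fun x => ?_)
    simpa using pow_le_pow_left₀ (norm_nonneg _) (norm_le_pi_norm x v) 2
  · refine Asymptotics.IsBigO.fun_sum fun p _ => ?_
    induction p using Sym2.ind with
    | _ u v =>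
      refine Asymptotics.IsBigO.of_bound 1 (Filter.Eventually.of_forall fun x => ?_)
      simpa [sq] using mul_le_mul (norm_le_pi_norm x u) (norm_le_pi_norm x v) (norm_nonneg _)
        (norm_nonneg _)

theorem differentiable_clusterL1 : Differentiable ℂ (clusterL1 : (V → ℂ) → ℂ) := by
  unfold clusterL1
  fun_prop

theorem differentiable_clusterL2 : Differentiable ℂ (clusterL2 G) := by
  unfold clusterL2
  refine Differentiable.sub (by fun_prop) (Differentiable.fun_sum fun p _ => ?_)
  induction p using Sym2.ind with
  | _ u v =>
    simp only [Sym2.map_mk, Sym2.mul_mk]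
    fun_prop

theorem differentiable_hardcoreZ : Differentiable ℂ (hardcoreZ G) := by
  classical
  rw [show hardcoreZ G = _ from funext fun x => hardcoreZ_eq_sum G x]
  refine Differentiable.fun_sum fun I _ => ?_
  split_ifs
  · fun_prop
  · fun_prop

theorem differentiable_hardcoreF2 : Differentiable ℂ (hardcoreF2 G) :=
  (differentiable_hardcoreZ G).mul
    ((differentiable_clusterL1.neg.sub (differentiable_clusterL2 G)).cexp)

theorem cexp_sub_isBigO :
    (fun z : ℂ => cexp z - (1 + z + z ^ 2 / 2)) =O[nhds 0] fun z => z ^ 3 := by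
  refine Asymptotics.IsBigO.of_bound 1 ?_
  filter_upwards [Metric.closedBall_mem_nhds (0 : ℂ) one_pos] with z hz
  have := Complex.exp_bound (x := z) (by simpa using hz) (n := 3) (by norm_num)
  simp [Finset.sum_range_succ, Nat.factorial] at this
  rw [norm_pow, one_mul]
  nlinarith [pow_nonneg (norm_nonneg z) 3]

/-- The second-order reweighting removes all terms of degree one and two. -/
theorem hardcoreF2_sub_one_isBigO :
    (fun x => hardcoreF2 G x - 1) =O[nhds 0] fun x => ‖x‖ ^ 3 := by
  let u : (V → ℂ) → ℂ := fun x => clusterL1 x + clusterL2 G x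
  have hu : u =O[nhds 0] fun x => ‖x‖ := by
    refine clusterL1_isBigO.add ((clusterL2_isBigO G).trans ?_)
    simpa using norm_pow_isBigO_norm_pow (V := V) (k := 1) (l := 2) (by norm_num)
  have hud : Differentiable ℂ u := differentiable_clusterL1.add (differentiable_clusterL2 G)
  have hu0 : Filter.Tendsto u (nhds 0) (nhds 0) :=
    hu.trans_tendsto (by simpa using (continuous_norm (E := V → ℂ)).tendsto 0)
  have h1 : (fun x => cexp (u x) - (1 + u x + u x ^ 2 / 2)) =O[nhds 0] fun x => ‖x‖ ^ 3 :=
    (cexp_sub_isBigO.comp_tendsto hu0).trans (hu.pow 3)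
  have h2 : (fun x => clusterL1 x * clusterL2 G x) =O[nhds 0] fun x => ‖x‖ ^ 3 := by
    refine (clusterL1_isBigO.mul (clusterL2_isBigO G)).congr_right fun x => by ring
  have h3 : (fun x => clusterL2 G x ^ 2) =O[nhds 0] fun x => ‖x‖ ^ 3 := by
    refine ((clusterL2_isBigO G).pow 2).trans ?_
    simp only [← pow_mul]
    exact norm_pow_isBigO_norm_pow (by norm_num)
  have h4 : (fun x => cexp (-u x)) =O[nhds 0] fun _ => (1 : ℝ) :=
    (hud.neg.cexp.continuous.tendsto 0).isBigO_one ℝ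
  -- With `u = L₁ + L₂`, the quadratic Taylor polynomials of `Z` and `exp u` differ only by `L₁ L₂ +
  -- L₂² / 2`. The bracket is therefore `Z - exp u`, and multiplication by `exp (-u)` gives `F⁽²⁾ -
  -- 1`.
  have h5 := h4.mul ((((hardcoreZ_sub_isBigO G).sub h1).sub h2).sub (h3.const_mul_left (1 / 2)))
  refine h5.congr (fun x => ?_) fun x => by simp
  have h6 : cexp (-u x) * cexp (u x) = 1 := by rw [← Complex.exp_add]; simp
  rw [hardcoreF2, show -clusterL1 x - clusterL2 G x = -u x by simp only [u]; ring]
  simp only [u] at h6 ⊢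
  linear_combination -h6

theorem hardcoreF2_zero : hardcoreF2 G 0 = 1 := by
  have := Asymptotics.IsBigO.eq_zero_of_norm_pow (x₀ := (0 : V → ℂ)) (n := 3)
    (by simpa using hardcoreF2_sub_one_isBigO G) (by norm_num)
  exact sub_eq_zero.1 this

end

/-! ### Removing the multiplicative constant -/

/-- Pythagoras: `f - f 0` has circle mean zero, so it is orthogonal to constants. -/
theorem lintegral_unitPoint_enorm_sq_eq {f : ℂ → ℂ} (hf : Differentiable ℂ f) :
    ∫⁻ θ, ‖f (unitPoint θ)‖ₑ ^ 2 ∂angleMeasure =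
      ‖f 0‖ₑ ^ 2 + ∫⁻ θ, ‖f (unitPoint θ) - f 0‖ₑ ^ 2 ∂angleMeasure := by
  have hcont : Continuous fun θ => f (unitPoint θ) := hf.continuous.comp (continuous_circleMap 0 1)
  have hint : ∀ {g : ℝ → ℝ}, Continuous g → Integrable g angleMeasure := fun hg =>
    ((hg.continuousOn.integrableOn_Icc (a := 0) (b := 2 * Real.pi)).mono_set
      Set.Ioc_subset_Icc_self).smul_measure ENNReal.ofReal_ne_top
  have hint' : ∀ {g : ℝ → ℂ}, Continuous g → Integrable g angleMeasure := fun hg =>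
    ((hg.continuousOn.integrableOn_Icc (a := 0) (b := 2 * Real.pi)).mono_set
      Set.Ioc_subset_Icc_self).smul_measure ENNReal.ofReal_ne_top
  have key : ∀ {g : ℝ → ℂ}, Continuous g → ∫⁻ θ, ‖g θ‖ₑ ^ 2 ∂angleMeasure =
      ENNReal.ofReal (∫ θ, ‖g θ‖ ^ 2 ∂angleMeasure) := by
    intro g hg
    rw [ofReal_integral_eq_lintegral_ofReal (hint (by fun_prop))
      (Filter.Eventually.of_forall fun _ => by positivity)]
    refine lintegral_congr fun q => ?_
    rw [← ofReal_norm, ENNReal.ofReal_pow (norm_nonneg _)]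
  have hzero : ∫ θ, (conj (f 0) * (f (unitPoint θ) - f 0)).re ∂angleMeasure = 0 := by
    have h := integral_unitPoint_of_differentiable (f := fun w => conj (f 0) * (f w - f 0))
      (by fun_prop)
    have h' := integral_re (𝕜 := ℂ) (hint' (g := fun θ => conj (f 0) * (f (unitPoint θ) - f 0))
      (continuous_const.mul (hcont.sub continuous_const)))
    simp only [RCLike.re_to_complex] at h'
    rw [h', h]
    simp
  rw [key hcont, key (g := fun θ => f (unitPoint θ) - f 0) (hcont.sub continuous_const), ← ofReal_norm,
    ← ENNReal.ofReal_pow (by positivity), ← ENNReal.ofReal_add (by positivity) (by positivity)]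
  congr 1
  have hpt : ∀ θ, ‖f (unitPoint θ)‖ ^ 2 = (‖f 0‖ ^ 2 + ‖f (unitPoint θ) - f 0‖ ^ 2) +
      2 * (conj (f 0) * (f (unitPoint θ) - f 0)).re := by
    intro θ
    simp only [← Complex.normSq_eq_norm_sq, Complex.normSq_apply, Complex.mul_re, Complex.sub_re,
      Complex.sub_im, Complex.conj_re, Complex.conj_im]
    ring
  simp only [hpt]
  have hd : Continuous fun θ => f (unitPoint θ) - f 0 := hcont.sub continuous_const
  have hd2 : Integrable (fun θ => ‖f (unitPoint θ) - f 0‖ ^ 2) angleMeasure :=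
    hint (hd.norm.pow 2)
  have hre : Integrable (fun θ => (conj (f 0) * (f (unitPoint θ) - f 0)).re) angleMeasure :=
    hint (Complex.continuous_re.comp (continuous_const.mul hd))
  rw [integral_add (f := fun θ => ‖f 0‖ ^ 2 + ‖f (unitPoint θ) - f 0‖ ^ 2)
      ((integrable_const _).add hd2) (hre.const_mul 2),
    integral_add (integrable_const _) hd2, integral_const_mul, hzero]
  simp

/-- The Gaussian second moment of an entire function splits into its value at the origin and the
second moment of the difference. -/
theorem lintegral_enorm_sq_stdComplexGaussianPi_eq {ι : Type*} [Fintype ι] {h : (ι → ℂ) → ℂ}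
    (hh : Differentiable ℂ h) :
    ∫⁻ x, ‖h x‖ₑ ^ 2 ∂stdComplexGaussianPi ι =
      ‖h 0‖ₑ ^ 2 + ∫⁻ x, ‖h x - h 0‖ₑ ^ 2 ∂stdComplexGaussianPi ι := by
  have hm : Measurable h := hh.continuous.measurable
  rw [← lintegral_lintegral_unitPoint_smul (by fun_prop),
    ← lintegral_lintegral_unitPoint_smul (g := fun x => ‖h x - h 0‖ₑ ^ 2) (by fun_prop)]
  have h1 : ∀ x : ι → ℂ, _ := fun x =>
    lintegral_unitPoint_enorm_sq_eq (f := fun z => h (z • x)) (by fun_prop)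
  simp only [zero_smul] at h1
  simp only [h1]
  rw [lintegral_add_left measurable_const]
  simp

theorem lintegral_smul_eq_of_norm {ι : Type*} [Fintype ι] {g : (ι → ℂ) → ENNReal}
    (hg : Measurable g) (z : ℂ) :
    ∫⁻ x, g (z • x) ∂stdComplexGaussianPi ι =
      ∫⁻ x, g ((‖z‖ : ℂ) • x) ∂stdComplexGaussianPi ι := by
  by_cases hz : z = 0
  · simp [hz]
  have hz' : (‖z‖ : ℂ) ≠ 0 := by simpa using hz
  have h := (measurePreserving_smul_stdComplexGaussianPi (ι := ι) (c := z / ‖z‖)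
    (by simp [hz])).lintegral_comp (hg.comp (measurable_const_smul (‖z‖ : ℂ)))
  refine Eq.trans ?_ h
  refine lintegral_congr fun x => ?_
  simp only [Function.comp, smul_smul, mul_div_cancel₀ _ hz']

theorem exists_lintegral_hardcoreF2_le :
    ∃ K : ℝ, 1 ≤ K ∧ ∀ (n : ℕ) (z : ℂ), 1 ≤ n → n * ‖z‖ ^ 2 ≤ 1 / 3840 →
      ∫⁻ x, ‖hardcoreF2 (lineGraphKnn n) (z • x)‖ₑ ^ 2 ∂stdComplexGaussianPi (Fin n × Fin n) ≤
        ENNReal.ofReal (K * Real.exp (7434240 * (n ^ 4 * ‖z‖ ^ 6))) := by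
  set J := ∫⁻ ζ, ENNReal.ofReal (Real.exp (1 / 2 * ‖ζ‖ ^ 2)) ∂stdComplexGaussian with hJ
  have hJt : J ≠ ⊤ := lintegral_exp_half_norm_sq_lt_top.ne
  refine ⟨1 + J.toReal * Real.exp 1, le_add_of_nonneg_right (by positivity), fun n z hn hz => ?_⟩
  have hF := (differentiable_hardcoreF2 (lineGraphKnn n)).continuous.measurable
  rw [lintegral_smul_eq_of_norm (g := fun x => ‖hardcoreF2 (lineGraphKnn n) x‖ₑ ^ 2)
    (hF.enorm.pow_const 2)]
  refine (lintegral_hardcoreF2_lineGraphKnn_le hn (norm_nonneg z) hz).trans ?_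
  rw [← hJ, ← ENNReal.ofReal_toReal hJt, ← ENNReal.ofReal_mul (by positivity),
    ← ENNReal.ofReal_mul (by positivity), ENNReal.toReal_ofReal (by positivity)]
  refine ENNReal.ofReal_le_ofReal ?_
  have e : 14520 * n * (8 * (n * ‖z‖ ^ 2)) ^ 3 = 7434240 * (n ^ 4 * ‖z‖ ^ 6) := by ring
  rw [e]
  have := Real.exp_pos (7434240 * (n ^ 4 * ‖z‖ ^ 6))
  nlinarith

/-- The bound with a constant `K` is applied at a reference radius `r` where it is itself a constant
`K'`. Below `r / 2` the third-order vanishing transfers it to `z` with the factor `4 (|z| / r)⁶`,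
proportional to `n⁴|z|⁶`; above `r / 2` the quantity `n⁴|z|⁶` is bounded below, and a multiple of it
dominates `log K`. -/
theorem exists_log_lintegral_hardcoreF2_le :
    ∃ c C : ℝ, 0 < c ∧ 0 < C ∧ ∀ (n : ℕ) (z : ℂ), (n : ℝ) * ‖z‖ ^ 2 ≤ c →
      ∫⁻ x, ‖hardcoreF2 (lineGraphKnn n) (z • x)‖ₑ ^ 2 ∂stdComplexGaussianPi (Fin n × Fin n) ≤
        ENNReal.ofReal (Real.exp (C * n ^ 4 * ‖z‖ ^ 6)) := by
  obtain ⟨K, hK, hM⟩ := exists_lintegral_hardcoreF2_le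
  set c : ℝ := 1 / 3840 with hc
  have hc0 : 0 < c := by norm_num [hc]
  set K' : ℝ := K * Real.exp (7434240 * c ^ 3) with hK'
  have hK'0 : 0 < K' := by positivity
  refine ⟨c, 4 * K' / c ^ 3 + (64 * K / c ^ 3 + 7434240), hc0, by positivity, fun n z hz => ?_⟩
  rcases Nat.eq_zero_or_pos n with rfl | hn
  · have : ∀ x : Fin 0 × Fin 0 → ℂ, hardcoreF2 (lineGraphKnn 0) (z • x) = 1 := fun x => by
      rw [Subsingleton.elim (z • x) 0, hardcoreF2_zero]
    simp [this]
  have hn' : (1 : ℝ) ≤ n := by exact_mod_cast hn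
  have hn0 : (0 : ℝ) < n := by linarith
  have hF := differentiable_hardcoreF2 (lineGraphKnn n)
  -- This radius makes `n⁴ r⁶ = c³`; it is admissible because `(n r²)³ = n³ r⁶ ≤ n⁴ r⁶`.
  obtain ⟨r, hr0, hr⟩ : ∃ r : ℝ, 0 < r ∧ r ^ 6 = c ^ 3 / n ^ 4 := by
    refine ⟨(c ^ 3 / n ^ 4) ^ ((6 : ℕ) : ℝ)⁻¹, by positivity, ?_⟩
    exact Real.rpow_inv_natCast_pow (by positivity) (by norm_num)
  have hnr : (n : ℝ) ^ 4 * r ^ 6 = c ^ 3 := by rw [hr]; field_simp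
  have hrc : n * r ^ 2 ≤ c := by
    refine le_of_pow_le_pow_left₀ (n := 3) (by norm_num) hc0.le ?_
    rw [← hnr]
    have : (n : ℝ) ^ 3 ≤ n ^ 4 := pow_le_pow_right₀ hn' (by norm_num)
    have h6 : 0 ≤ r ^ 6 := by positivity
    calc (n * r ^ 2) ^ 3 = n ^ 3 * r ^ 6 := by ring
      _ ≤ _ := mul_le_mul_of_nonneg_right this h6
  have hT : 0 ≤ (n : ℝ) ^ 4 * ‖z‖ ^ 6 := by positivity
  set T := (n : ℝ) ^ 4 * ‖z‖ ^ 6 with hTdef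
  rw [mul_assoc, ← hTdef]
  by_cases hzr : ‖z‖ ≤ r / 2
  · have h1 := lintegral_enorm_sq_stdComplexGaussianPi_eq (ι := Fin n × Fin n)
      (h := fun x => hardcoreF2 (lineGraphKnn n) ((r : ℂ) • x)) (by fun_prop)
    have h2 := lintegral_enorm_sq_stdComplexGaussianPi_eq (ι := Fin n × Fin n)
      (h := fun x => hardcoreF2 (lineGraphKnn n) (z • x)) (by fun_prop)
    simp only [smul_zero, hardcoreF2_zero, enorm_one, one_pow] at h1 h2
    have h3 := lintegral_smul_le_of_isBigO_pow_three
      (h := fun x => hardcoreF2 (lineGraphKnn n) x - 1) (by fun_prop)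
      (hardcoreF2_sub_one_isBigO _) hr0 hzr
    have h4 := hM n r hn (by simpa [abs_of_pos hr0] using hrc)
    rw [Complex.norm_real, Real.norm_of_nonneg hr0.le, hnr, ← hK'] at h4
    have h5 := (le_add_left le_rfl).trans (h1.ge.trans h4)
    have h6 : (‖z‖ / r) ^ 6 = T / c ^ 3 := by
      rw [hTdef, div_pow, hr]; field_simp
    rw [h2]
    calc _ ≤ ENNReal.ofReal 1 + ENNReal.ofReal (4 * (‖z‖ / r) ^ 6) * ENNReal.ofReal K' := by
          rw [ENNReal.ofReal_one]
          exact add_le_add le_rfl (h3.trans (mul_le_mul' le_rfl h5))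
      _ = ENNReal.ofReal (4 * K' / c ^ 3 * T + 1) := by
          rw [← ENNReal.ofReal_mul (by positivity), ← ENNReal.ofReal_add (by norm_num)
            (by positivity), h6]
          congr 1; ring
      _ ≤ _ := by
          refine ENNReal.ofReal_le_ofReal ((Real.add_one_le_exp _).trans (Real.exp_le_exp.2 ?_))
          have : 0 ≤ (64 * K / c ^ 3 + 7434240) * T := by positivity
          linarith
  · refine (hM n z hn hz).trans (ENNReal.ofReal_le_ofReal ?_)
    -- The factor `64 = 2 ^ 6` comes from `‖z‖ > r / 2`.
    have h1 : 1 ≤ 64 / c ^ 3 * T := by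
      have h2 : (r / 2) ^ 6 ≤ ‖z‖ ^ 6 := pow_le_pow_left₀ (by positivity) (not_le.1 hzr).le 6
      have h3 : (n : ℝ) ^ 4 * (r / 2) ^ 6 ≤ T := mul_le_mul_of_nonneg_left h2 (by positivity)
      rw [div_mul_eq_mul_div, le_div_iff₀ (by positivity), ← hnr]
      linarith
    have h2 : K ≤ Real.exp (64 * K / c ^ 3 * T) := by
      refine le_trans ?_ (Real.add_one_le_exp _)
      have : K * 1 ≤ K * (64 / c ^ 3 * T) := mul_le_mul_of_nonneg_left h1 (by linarith)
      have e : 64 * K / c ^ 3 * T = K * (64 / c ^ 3 * T) := by ring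
      rw [e]; linarith
    calc K * Real.exp (7434240 * T)
        ≤ Real.exp (64 * K / c ^ 3 * T) * Real.exp (7434240 * T) :=
          mul_le_mul_of_nonneg_right h2 (Real.exp_pos _).le
      _ = Real.exp ((64 * K / c ^ 3 + 7434240) * T) := by rw [← Real.exp_add]; congr 1; ring
      _ ≤ _ := by
          refine Real.exp_le_exp.2 ?_
          have : 0 ≤ 4 * K' / c ^ 3 * T := by positivity
          linarith

theorem mainTheorem8 :
    ∃ c C : ℝ, 0 < c ∧ 0 < C ∧
      ∀ (n : ℕ) (Ω : Type*) [MeasurableSpace Ω] (P : Measure Ω) [IsProbabilityMeasure P]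
        (W : Fin n × Fin n → Ω → ℂ),
        (∀ e, HasLaw (W e) stdComplexGaussian P) → iIndepFun W P →
        ∀ z : ℂ, (n : ℝ) * ‖z‖ ^ 2 ≤ c →
          Integrable (fun ω => ‖hardcoreF2 (lineGraphKnn n) (fun e => z * W e ω)‖ ^ 2) P ∧
          0 < ∫ ω, ‖hardcoreF2 (lineGraphKnn n) (fun e => z * W e ω)‖ ^ 2 ∂P ∧
          Real.log (∫ ω, ‖hardcoreF2 (lineGraphKnn n) (fun e => z * W e ω)‖ ^ 2 ∂P)
            ≤ C * (n : ℝ) ^ 4 * ‖z‖ ^ 6 := by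
  obtain ⟨c, C, hc, hC, h⟩ := exists_log_lintegral_hardcoreF2_le
  refine ⟨c, C, hc, hC, fun n Ω _ P _ W hW hind z hz => ?_⟩
  have hM := h n z hz
  have hF := differentiable_hardcoreF2 (lineGraphKnn n)
  have hF0 := hardcoreF2_zero (lineGraphKnn n)
  have hlaw : HasLaw (fun ω e => W e ω) (stdComplexGaussianPi (Fin n × Fin n)) P :=
    hind.hasLaw_pi hW
  have hFz : Continuous fun x => hardcoreF2 (lineGraphKnn n) (z • x) :=
    hF.continuous.comp (continuous_const_smul z)
  -- The mean value inequality gives second moment at least `|F⁽²⁾(0)|² = 1`, hence positivity.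
  have hone := enorm_sq_le_lintegral_stdComplexGaussianPi
    (h := fun x => hardcoreF2 (lineGraphKnn n) (z • x)) (by fun_prop)
  simp only [smul_zero, hF0, enorm_one, one_pow] at hone
  have hmap : ∫⁻ ω, ENNReal.ofReal (‖hardcoreF2 (lineGraphKnn n) (fun e => z * W e ω)‖ ^ 2) ∂P =
      ∫⁻ x, ‖hardcoreF2 (lineGraphKnn n) (z • x)‖ₑ ^ 2 ∂stdComplexGaussianPi (Fin n × Fin n) := by
    rw [← hlaw.map_eq, lintegral_map' (hFz.measurable.enorm.pow_const 2).aemeasurable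
      hlaw.aemeasurable]
    refine lintegral_congr fun ω => ?_
    rw [← ofReal_norm, ENNReal.ofReal_pow (norm_nonneg _)]
    rfl
  have hmeas : AEStronglyMeasurable
      (fun ω => ‖hardcoreF2 (lineGraphKnn n) (fun e => z * W e ω)‖ ^ 2) P :=
    ((hFz.norm.pow 2).measurable.comp_aemeasurable hlaw.aemeasurable).aestronglyMeasurable
  have hint : Integrable (fun ω => ‖hardcoreF2 (lineGraphKnn n) (fun e => z * W e ω)‖ ^ 2) P := by
    refine ⟨hmeas, ?_⟩
    rw [hasFiniteIntegral_iff_ofReal (Filter.Eventually.of_forall fun _ => by positivity), hmap]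
    exact hM.trans_lt ENNReal.ofReal_lt_top
  have hE : ENNReal.ofReal (∫ ω, ‖hardcoreF2 (lineGraphKnn n) (fun e => z * W e ω)‖ ^ 2 ∂P) =
      ∫⁻ x, ‖hardcoreF2 (lineGraphKnn n) (z • x)‖ₑ ^ 2 ∂stdComplexGaussianPi (Fin n × Fin n) := by
    rw [ofReal_integral_eq_lintegral_ofReal hint
      (Filter.Eventually.of_forall fun _ => by positivity), hmap]
  rw [← hE] at hone hM
  have hpos : 0 < ∫ ω, ‖hardcoreF2 (lineGraphKnn n) (fun e => z * W e ω)‖ ^ 2 ∂P :=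
    zero_lt_one.trans_le (ENNReal.one_le_ofReal.1 hone)
  refine ⟨hint, hpos, ?_⟩
  rw [Real.log_le_iff_le_exp hpos]
  exact (ENNReal.ofReal_le_ofReal_iff (Real.exp_pos _).le).1 hM
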